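/- Let $G:\mathbb{R}^2\to[0,+\infty)$ be a radial kernel, that is, $G(x)=g(|x|)$ for a.e. $x$ with a measurable $g:(0,+\infty)\to[0,+\infty)$, whose first moment is finite and normalized by \[ \int_{\mathbb{R}^2}|x|\,G(x)\,dx=\frac{1}{\mathbf K_{1,2}},\qquad \mathbf K_{1,2}=\frac{1}{2\pi}\int_{\mathbb{S}^1}|\sigma\cdot\nu|\,d\mathcal H^1(\sigma)=\frac{2}{\pi}\quad(\nu\in\mathbb{S}^1). \] For $\varepsilon>0$ put $G_\varepsilon(x)=\varepsilon^{-3}G(\varepsilon^{-1}x)$. For a set $E\subseteq\mathbb{R}^2$ of finite perimeter (that is, $E$ is Lebesgue measurable and $\mathbf 1_E\in BV(\mathbb{R}^2)$) let $P(E)=\int_{\mathbb{R}^2}|D\mathbf 1_E|$ be its perimeter, and let \[ P_{G_\varepsilon}(E)=2\iint_{E\times(\mathbb{R}^2\setminus E)}G_\varepsilon(x-y)\,dx\,dy,\qquad \mathcal E_{G_\varepsilon}(E)=P(E)-P_{G_\varepsilon}(E). \] Let $E\subseteq\mathbb{R}^2$ be a bounded, connected set of finite perimeter that has no Lebesgue-negligible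 parts, in the sense that $\mathcal H^1$-almost every point of $E$ is not a point of Lebesgue density $0$ of $E$: \[ \mathcal H^1\Big(\Big\{x\in E:\ \lim_{r\to0^+}\frac{|E\cap B_r(x)|}{|B_r(x)|}=0\Big\}\Big)=0 . \] (This holds, for instance, if $E$ is open, or if every point of $E$ is a point of density $1$ of $E$.) Then the convex hull $\mathrm{co}(E)$ is a set of finite perimeter, and for every $\varepsilon>0$ the quantities $P_{G_\varepsilon}(E)$ and $P_{G_\varepsilon}(\mathrm{co}(E))$ are finite and \[ \mathcal E_{G_\varepsilon}(\mathrm{co}(E))\le\mathcal E_{G_\varepsilon}(E). \] -/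

import Mathlib

open MeasureTheory Metric Topology Filter
open scoped ENNReal

noncomputable section

/-- Divergence of a vector field on `ℝⁿ`. -/
def divergence {n : ℕ} (φ : EuclideanSpace ℝ (Fin n) → EuclideanSpace ℝ (Fin n))
    (x : EuclideanSpace ℝ (Fin n)) : ℝ :=
  ∑ i : Fin n, (fderiv ℝ φ x (EuclideanSpace.single i 1)) i

/-- The perimeter of `E ⊆ ℝⁿ`: the total variation of the distributional gradient of `1_E`, that
is, the supremum of `∫_E div φ` over `φ ∈ C¹_c(ℝⁿ; ℝⁿ)` with `|φ| ≤ 1`. -/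
def perimeter {n : ℕ} (E : Set (EuclideanSpace ℝ (Fin n))) : ℝ≥0∞ :=
  ⨆ (φ : EuclideanSpace ℝ (Fin n) → EuclideanSpace ℝ (Fin n)) (_ : ContDiff ℝ 1 φ)
    (_ : HasCompactSupport φ) (_ : ∀ x, ‖φ x‖ ≤ 1),
    ENNReal.ofReal (∫ x in E, divergence φ x)

/-- `E` is a set of finite perimeter: it is Lebesgue measurable and `1_E ∈ BV(ℝⁿ)`. -/
structure HasFinitePerimeter {n : ℕ} (E : Set (EuclideanSpace ℝ (Fin n))) : Prop where
  nullMeasurable : NullMeasurableSet E volume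
  volume_ne_top : volume E ≠ ∞
  perimeter_ne_top : perimeter E ≠ ∞

/-- The nonlocal perimeter `P_K(E) = 2 ∬_{E × Eᶜ} K(x - y) dx dy` (for `K ≥ 0`). -/
def nonlocalPerimeter {n : ℕ} (K : EuclideanSpace ℝ (Fin n) → ℝ)
    (E : Set (EuclideanSpace ℝ (Fin n))) : ℝ≥0∞ :=
  2 * ∫⁻ x in E, ∫⁻ y in Eᶜ, ENNReal.ofReal (K (x - y))

/-- The rescaled kernel `G_ε(x) = ε^{-(n+1)} G(x / ε)`. -/
def rescaledKernel {n : ℕ} (G : EuclideanSpace ℝ (Fin n) → ℝ) (ε : ℝ) :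
    EuclideanSpace ℝ (Fin n) → ℝ :=
  fun x => (ε ^ (n + 1))⁻¹ * G (ε⁻¹ • x)

/-- The critical energy `P(E) - P_K(E)`, meaningful when both terms are finite. -/
def criticalEnergy {n : ℕ} (K : EuclideanSpace ℝ (Fin n) → ℝ)
    (E : Set (EuclideanSpace ℝ (Fin n))) : ℝ :=
  (perimeter E).toReal - (nonlocalPerimeter K E).toReal

/-- `G` is nonnegative and radial: `G(x) = g(|x|)` for a.e. `x`, with `g` measurable and
nonnegative on `(0, ∞)`. -/
def IsRadialKernel {n : ℕ} (G : EuclideanSpace ℝ (Fin n) → ℝ) : Prop :=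
  (∀ x, 0 ≤ G x) ∧
    ∃ g : ℝ → ℝ, Measurable g ∧ (∀ r, 0 < r → 0 ≤ g r) ∧ ∀ᵐ x, G x = g ‖x‖

/-- The average of `|σ · ν|` over `σ` in the unit sphere, for the surface measure. It is the same
constant `K_{1,n}` for every unit vector `ν`. -/
def sphereMeanAbsInner {n : ℕ} (ν : EuclideanSpace ℝ (Fin n)) : ℝ :=
  ⨍ σ : sphere (0 : EuclideanSpace ℝ (Fin n)) 1,
    |inner ℝ (σ : EuclideanSpace ℝ (Fin n)) ν|
      ∂(volume : Measure (EuclideanSpace ℝ (Fin n))).toSphere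

/-- The first moment `∫ |x| G(x) dx` is finite and equal to `1 / K_{1,n}`. -/
def HasNormalizedFirstMoment {n : ℕ} (G : EuclideanSpace ℝ (Fin n) → ℝ) : Prop :=
  Integrable (fun x => ‖x‖ * G x) ∧
    ∀ ν : EuclideanSpace ℝ (Fin n), ‖ν‖ = 1 →
      ∫ x, ‖x‖ * G x = 1 / sphereMeanAbsInner ν

/-- The points of Lebesgue density `0` of `E`. -/
def densityZeroPoints {n : ℕ} (E : Set (EuclideanSpace ℝ (Fin n))) :
    Set (EuclideanSpace ℝ (Fin n)) :=
  {x | Tendsto (fun r : ℝ => volume (E ∩ ball x r) / volume (ball x r)) (𝓝[>] 0) (𝓝 0)}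

end

noncomputable section

set_option linter.unusedSectionVars false

/-! The energy is an integral of one-dimensional energies over all lines of the plane, and the
inequality holds line by line. Let `k` be the rescaled radial kernel. The moment normalization says
exactly that `∫ k z * |L z| dz = ‖L‖` for every linear functional `L`
(`lintegral_rescaledProfile_mul_enorm`). Applied to gradients of mollifications of the indicator, it
gives the perimeter as `∫ k z * dirVar 1_E z dz` (`perimeter_eq_lintegral_dirVar`), while
symmetrizing the double integral gives the nonlocal perimeter as `∫ k z * transDiff 1_E z dz`
(`nonlocalPerimeter_eq_lintegral_transDiff`). For fixed `z`, Fubini splits both integrands over the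
lines parallel to `z`.

On such a line let `A` be the slice of (a measurable version of) `E`, and `I ⊇ A` the slice of the
hull, an interval. Let `r = |z|`. If `A` has positive measure, its variation costs at least `2r`
(`two_mul_ofReal_le_dirVar`), whereas `I` costs at most `2r` and its translation difference is at
least `2 min(r, |I|)`. If `r ≤ |I|`, the deficit of `I` vanishes and that of `A` is nonnegative. If
`r ≥ |I|`, the translation difference of `A` is at most `2|A| ≤ 2|I|`, so `I` wins in both terms
(`dirVar_le_and_add_transDiff_le_of_ordConnected`).

It remains to exclude lines where `I` has positive length and `A` is null
(`ae_volume_slice_ne_zero`). By connectedness every line meeting the hull meets `E`. For almost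
every line, a null slice forces all points of the line to have density `0`, and by hypothesis almost
no line meets `E` in such a point. -/

theorem two_pow_mul_enorm (m : ℕ) (a : ℝ) : (2 : ℝ≥0∞) ^ m * ‖a‖ₑ = ‖(2 : ℝ) ^ m * a‖ₑ := by
  have h2 : ‖(2 : ℝ)‖ₑ = 2 := by rw [Real.enorm_eq_ofReal two_pos.le]; simp
  rw [enorm_mul, enorm_pow, h2]

/-! ### Translation differences and directional variation of functions. -/

section Translation

variable {V : Type*} [NormedAddCommGroup V] [NormedSpace ℝ V] [MeasureSpace V] [BorelSpace V]
  [FiniteDimensional ℝ V] [(volume : Measure V).IsAddHaarMeasure]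

/-- The `L¹` distance between `f` and its translate by `w`. -/
def transDiff (f : V → ℝ) (w : V) : ℝ≥0∞ := ∫⁻ x, ‖f (x + w) - f x‖ₑ

/-- The total variation of `f` in direction `z` (scaled by `‖z‖`), as a supremum of dyadic
difference quotients. -/
def dirVar (f : V → ℝ) (z : V) : ℝ≥0∞ :=
  ⨆ n : ℕ, 2 ^ n * transDiff f (((2 : ℝ) ^ n)⁻¹ • z)

theorem transDiff_congr_ae {f g : V → ℝ} (h : f =ᵐ[volume] g) (w : V) :
    transDiff f w = transDiff g w := by
  refine lintegral_congr_ae ?_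
  filter_upwards [h, (quasiMeasurePreserving_add_right volume w).ae h] with x h1 h2
  rw [h1, h2]

theorem dirVar_congr_ae {f g : V → ℝ} (h : f =ᵐ[volume] g) (z : V) :
    dirVar f z = dirVar g z := by
  simp only [dirVar, transDiff_congr_ae h]

theorem transDiff_add_le {f : V → ℝ} (hf : Measurable f) (v w : V) :
    transDiff f (v + w) ≤ transDiff f v + transDiff f w := by
  have h : transDiff f w = ∫⁻ x, ‖f (x + v + w) - f (x + v)‖ₑ :=
    (lintegral_add_right_eq_self (μ := volume) (fun x => ‖f (x + w) - f x‖ₑ) v).symm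
  rw [h, transDiff, transDiff, ← lintegral_add_left (by fun_prop)]
  refine lintegral_mono fun x => ?_
  calc ‖f (x + (v + w)) - f x‖ₑ
      = ‖(f (x + v) - f x) + (f (x + v + w) - f (x + v))‖ₑ := by
        rw [← add_assoc]; congr 1; ring
    _ ≤ _ := enorm_add_le _ _

/-- A step is two half steps, so subadditivity applies. Monotonicity turns the supremum in `dirVar`
into a monotone limit, which commutes with integration over lines and over `z`. -/
theorem transDiff_dyadic_monotone {f : V → ℝ} (hf : Measurable f) (z : V) :
    Monotone fun n : ℕ => (2 : ℝ≥0∞) ^ n * transDiff f (((2 : ℝ) ^ n)⁻¹ • z) := by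
  refine monotone_nat_of_le_succ fun n => ?_
  have h : ((2 : ℝ) ^ n)⁻¹ • z = ((2 : ℝ) ^ (n + 1))⁻¹ • z + ((2 : ℝ) ^ (n + 1))⁻¹ • z := by
    rw [← add_smul]; congr 1; field_simp; ring
  calc (2 : ℝ≥0∞) ^ n * transDiff f (((2 : ℝ) ^ n)⁻¹ • z)
      ≤ 2 ^ n * (transDiff f (((2 : ℝ) ^ (n + 1))⁻¹ • z)
          + transDiff f (((2 : ℝ) ^ (n + 1))⁻¹ • z)) := by
        rw [h]; gcongr; exact transDiff_add_le hf _ _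
    _ = _ := by rw [pow_succ]; ring

/-- The term `n = 0` of the supremum. Integrated against the kernel, this bounds the nonlocal
perimeter by the perimeter and yields the finiteness claims. -/
theorem transDiff_le_dirVar (f : V → ℝ) (z : V) : transDiff f z ≤ dirVar f z := by
  refine le_trans (by simp) (le_iSup (fun n : ℕ =>
    (2 : ℝ≥0∞) ^ n * transDiff f (((2 : ℝ) ^ n)⁻¹ • z)) 0)

theorem measurable_transDiff {f : V → ℝ} (hf : Measurable f) : Measurable (transDiff f) := by
  refine Measurable.lintegral_prod_right' (f := fun p : V × V => ‖f (p.2 + p.1) - f p.2‖ₑ) ?_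
  fun_prop

theorem measurable_dirVar {f : V → ℝ} (hf : Measurable f) : Measurable (dirVar f) := by
  refine Measurable.iSup fun n => ?_
  exact ((measurable_transDiff hf).comp (measurable_const_smul _)).const_mul _

theorem transDiff_le_two_mul {f : V → ℝ} (hf : Measurable f) (w : V) :
    transDiff f w ≤ 2 * ∫⁻ x, ‖f x‖ₑ := by
  calc transDiff f w ≤ ∫⁻ x, (‖f (x + w)‖ₑ + ‖f x‖ₑ) := lintegral_mono fun x => enorm_sub_le
    _ = (∫⁻ x, ‖f (x + w)‖ₑ) + ∫⁻ x, ‖f x‖ₑ := lintegral_add_left (by fun_prop) _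
    _ = _ := by rw [lintegral_add_right_eq_self (fun x => ‖f x‖ₑ) w, two_mul]

/-- Integrate the derivative along the segment from `x` to `x + w`, exchange the integrals, and use
translation invariance. -/
theorem transDiff_le_lintegral_fderiv {f : V → ℝ} (hf : ContDiff ℝ 1 f) (w : V) :
    transDiff f w ≤ ∫⁻ x, ‖fderiv ℝ f x w‖ₑ := by
  have hc : Continuous fun p : V × ℝ => fderiv ℝ f (p.1 + p.2 • w) w :=
    ((hf.continuous_fderiv one_ne_zero).comp (by fun_prop)).clm_apply continuous_const
  have key : ∀ x, ‖f (x + w) - f x‖ₑ ≤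
      ∫⁻ t in Set.Ioc (0 : ℝ) 1, ‖fderiv ℝ f (x + t • w) w‖ₑ := fun x => by
    have hd : ∀ t : ℝ, HasDerivAt (fun t : ℝ => f (x + t • w)) (fderiv ℝ f (x + t • w) w) t := by
      intro t
      have h1 : HasDerivAt (fun t : ℝ => x + t • w) w t := by
        simpa using ((hasDerivAt_id t).smul_const w).const_add x
      exact ((hf.differentiable one_ne_zero _).hasFDerivAt).comp_hasDerivAt t h1
    have hi := intervalIntegral.integral_eq_sub_of_hasDerivAt (a := 0) (b := 1)
      (fun t _ => hd t)
      ((hc.comp (by fun_prop : Continuous fun t : ℝ => (x, t))).intervalIntegrable _ _)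
    simp only [one_smul, zero_smul, add_zero] at hi
    rw [← hi, intervalIntegral.integral_of_le zero_le_one]
    exact enorm_integral_le_lintegral_enorm _
  calc transDiff f w ≤ ∫⁻ x, ∫⁻ t in Set.Ioc (0 : ℝ) 1, ‖fderiv ℝ f (x + t • w) w‖ₑ :=
        lintegral_mono key
    _ = ∫⁻ t in Set.Ioc (0 : ℝ) 1, ∫⁻ x, ‖fderiv ℝ f (x + t • w) w‖ₑ :=
        lintegral_lintegral_swap (hc.measurable.enorm.aemeasurable)
    _ = ∫⁻ t in Set.Ioc (0 : ℝ) 1, ∫⁻ x, ‖fderiv ℝ f x w‖ₑ := by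
        refine lintegral_congr fun t => ?_
        exact lintegral_add_right_eq_self (fun x => ‖fderiv ℝ f x w‖ₑ) (t • w)
    _ = _ := by simp

/-- Fatou's lemma for the dyadic difference quotients. -/
theorem lintegral_fderiv_le_dirVar {f : V → ℝ} (hf : Differentiable ℝ f) (z : V) :
    ∫⁻ x, ‖fderiv ℝ f x z‖ₑ ≤ dirVar f z := by
  have hm : Measurable f := hf.continuous.measurable
  have hlim : ∀ x, Tendsto (fun n : ℕ => (2 : ℝ≥0∞) ^ n * ‖f (x + ((2 : ℝ) ^ n)⁻¹ • z) - f x‖ₑ)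
      atTop (𝓝 ‖fderiv ℝ f x z‖ₑ) := fun x => by
    have h := ((hf x).hasFDerivAt.lim_real z).comp
      (tendsto_pow_atTop_atTop_of_one_lt (one_lt_two (α := ℝ)))
    refine h.enorm.congr fun n => ?_
    rw [two_pow_mul_enorm]
    simp
  calc ∫⁻ x, ‖fderiv ℝ f x z‖ₑ
      = ∫⁻ x, liminf (fun n : ℕ =>
          (2 : ℝ≥0∞) ^ n * ‖f (x + ((2 : ℝ) ^ n)⁻¹ • z) - f x‖ₑ) atTop :=
        lintegral_congr fun x => (hlim x).liminf_eq.symm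
    _ ≤ liminf (fun n : ℕ => ∫⁻ x, (2 : ℝ≥0∞) ^ n * ‖f (x + ((2 : ℝ) ^ n)⁻¹ • z) - f x‖ₑ) atTop :=
        lintegral_liminf_le fun n => by fun_prop
    _ ≤ dirVar f z := by
        refine liminf_le_of_le (by isBoundedDefault) fun b hb => ?_
        obtain ⟨n, hn⟩ := hb.exists
        refine hn.trans ?_
        rw [lintegral_const_mul _ (by fun_prop)]
        exact le_iSup (fun n : ℕ => (2 : ℝ≥0∞) ^ n * transDiff f (((2 : ℝ) ^ n)⁻¹ • z)) n

theorem transDiff_le_liminf {f : ℕ → V → ℝ} {g : V → ℝ} (hf : ∀ n, Measurable (f n))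
    (h : ∀ᵐ x, Tendsto (fun n => f n x) atTop (𝓝 (g x))) (w : V) :
    transDiff g w ≤ liminf (fun n => transDiff (f n) w) atTop := by
  refine le_trans (le_of_eq ?_) (lintegral_liminf_le fun n => by have := hf n; fun_prop)
  refine lintegral_congr_ae ?_
  filter_upwards [h, (quasiMeasurePreserving_add_right volume w).ae h] with x h1 h2
  exact ((h2.sub h1).enorm).liminf_eq.symm

open scoped Convolution in
-- The increment of the mollification is a `ρ`-average of translated increments of `f`, all having
-- the same `L¹` norm.
theorem transDiff_convolution_le {ρ f : V → ℝ} (hρ : Continuous ρ) (hρc : HasCompactSupport ρ)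
    (hρ0 : ∀ x, 0 ≤ ρ x) (hρ1 : ∫ x, ρ x = 1) (hf : Measurable f) (hfi : Integrable f) (w : V) :
    transDiff (ρ ⋆[ContinuousLinearMap.lsmul ℝ ℝ, volume] f) w ≤ transDiff f w := by
  have hex : ConvolutionExists ρ f (ContinuousLinearMap.lsmul ℝ ℝ) volume :=
    hρc.convolutionExists_left _ hρ hfi.locallyIntegrable
  have key : ∀ x, ‖(ρ ⋆[ContinuousLinearMap.lsmul ℝ ℝ, volume] f) (x + w)
      - (ρ ⋆[ContinuousLinearMap.lsmul ℝ ℝ, volume] f) x‖ₑ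
      ≤ ∫⁻ y, ‖ρ y‖ₑ * ‖f (x + w - y) - f (x - y)‖ₑ := fun x => by
    rw [convolution_def, convolution_def, ← integral_sub (hex _) (hex _)]
    refine (enorm_integral_le_lintegral_enorm _).trans (le_of_eq ?_)
    refine lintegral_congr fun y => ?_
    simp only [ContinuousLinearMap.lsmul_apply, smul_eq_mul]
    rw [← mul_sub, enorm_mul]
  have hρm := hρ.measurable
  calc transDiff (ρ ⋆[ContinuousLinearMap.lsmul ℝ ℝ, volume] f) w
      ≤ ∫⁻ x, ∫⁻ y, ‖ρ y‖ₑ * ‖f (x + w - y) - f (x - y)‖ₑ := lintegral_mono key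
    _ = ∫⁻ y, ∫⁻ x, ‖ρ y‖ₑ * ‖f (x + w - y) - f (x - y)‖ₑ :=
        lintegral_lintegral_swap (by fun_prop)
    _ = ∫⁻ y, ‖ρ y‖ₑ * transDiff f w := by
        refine lintegral_congr fun y => ?_
        rw [lintegral_const_mul _ (by fun_prop)]
        congr 1
        rw [transDiff, ← lintegral_sub_right_eq_self (fun x => ‖f (x + w) - f x‖ₑ) y]
        refine lintegral_congr fun x => ?_
        rw [sub_add_eq_add_sub]
    _ = transDiff f w := by
        rw [lintegral_mul_const _ (by fun_prop)]
        have : ∫⁻ y, ‖ρ y‖ₑ = 1 := by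
          rw [← ofReal_integral_norm_eq_lintegral_enorm (hρ.integrable_of_hasCompactSupport hρc)]
          simp only [Real.norm_of_nonneg (hρ0 _), hρ1, ENNReal.ofReal_one]
        rw [this, one_mul]

end Translation

/-! ### The perimeter as a kernel average of directional variations. -/

section Perimeter

variable {n : ℕ}

theorem perimeter_congr_ae {E F : Set (EuclideanSpace ℝ (Fin n))} (h : E =ᵐ[volume] F) :
    perimeter E = perimeter F := by
  simp only [perimeter, setIntegral_congr_set h]

theorem ofReal_integral_divergence_le_perimeter (E : Set (EuclideanSpace ℝ (Fin n)))
    {φ : EuclideanSpace ℝ (Fin n) → EuclideanSpace ℝ (Fin n)} (h1 : ContDiff ℝ 1 φ)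
    (h2 : HasCompactSupport φ) (h3 : ∀ x, ‖φ x‖ ≤ 1) :
    ENNReal.ofReal (∫ x in E, divergence φ x) ≤ perimeter E :=
  le_iSup_of_le φ <| le_iSup_of_le h1 <| le_iSup_of_le h2 <| le_iSup_of_le h3 le_rfl

theorem continuous_divergence {φ : EuclideanSpace ℝ (Fin n) → EuclideanSpace ℝ (Fin n)}
    (h1 : ContDiff ℝ 1 φ) : Continuous (divergence φ) := by
  have := h1.continuous_fderiv one_ne_zero
  unfold divergence
  fun_prop

theorem hasCompactSupport_divergence
    {φ : EuclideanSpace ℝ (Fin n) → EuclideanSpace ℝ (Fin n)}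
    (h2 : HasCompactSupport φ) : HasCompactSupport (divergence φ) := by
  refine (h2.fderiv ℝ).mono' fun x hx => subset_tsupport _ fun h0 => hx ?_
  simp [divergence, h0]

theorem fderiv_euclidean_apply {φ : EuclideanSpace ℝ (Fin n) → EuclideanSpace ℝ (Fin n)}
    {x : EuclideanSpace ℝ (Fin n)} (h : DifferentiableAt ℝ φ x) (v : EuclideanSpace ℝ (Fin n))
    (i : Fin n) : (fderiv ℝ φ x v) i = fderiv ℝ (fun y => φ y i) x v := by
  have := ((EuclideanSpace.proj (𝕜 := ℝ) i).hasFDerivAt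
    (x := φ x)).comp x h.hasFDerivAt
  have h2 : HasFDerivAt (fun y => φ y i)
    ((EuclideanSpace.proj (𝕜 := ℝ) i).comp (fderiv ℝ φ x)) x := this
  rw [h2.fderiv]
  rfl

/-- The vector representing a linear functional on Euclidean space. -/
def dualVector (L : EuclideanSpace ℝ (Fin n) →L[ℝ] ℝ) : EuclideanSpace ℝ (Fin n) :=
  WithLp.toLp 2 fun i => L (EuclideanSpace.single i 1)

theorem apply_eq_sum (L : EuclideanSpace ℝ (Fin n) →L[ℝ] ℝ) (v : EuclideanSpace ℝ (Fin n)) :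
    L v = ∑ i, L (EuclideanSpace.single i 1) * v i := by
  have hv : v = ∑ i, v i • EuclideanSpace.single i (1 : ℝ) := by
    ext j
    simp [Finset.sum_apply, Pi.single_apply]
  conv_lhs => rw [hv]
  simp [map_sum, mul_comm]

theorem innerSL_dualVector (L : EuclideanSpace ℝ (Fin n) →L[ℝ] ℝ) :
    innerSL ℝ (dualVector L) = L := by
  ext v
  rw [apply_eq_sum L v, innerSL_apply_apply, PiLp.inner_apply]
  simp [dualVector, mul_comm]

theorem norm_dualVector (L : EuclideanSpace ℝ (Fin n) →L[ℝ] ℝ) : ‖dualVector L‖ = ‖L‖ := by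
  conv_rhs => rw [← innerSL_dualVector L]
  exact (innerSL_apply_norm ℝ _).symm

theorem apply_dualVector (L : EuclideanSpace ℝ (Fin n) →L[ℝ] ℝ) : L (dualVector L) = ‖L‖ ^ 2 := by
  conv_lhs => rw [← innerSL_dualVector L, innerSL_dualVector L, ← innerSL_dualVector L]
  rw [innerSL_apply_apply, innerSL_dualVector, real_inner_self_eq_norm_sq, norm_dualVector]

theorem integral_mul_divergence {f : EuclideanSpace ℝ (Fin n) → ℝ}
    {φ : EuclideanSpace ℝ (Fin n) → EuclideanSpace ℝ (Fin n)}
    (hf : ContDiff ℝ 1 f) (h1 : ContDiff ℝ 1 φ) (h2 : HasCompactSupport φ) :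
    ∫ x, f x * divergence φ x = - ∫ x, fderiv ℝ f x (φ x) := by
  have hfc := hf.continuous
  have hf' := hf.continuous_fderiv one_ne_zero
  have hφ' := h1.continuous_fderiv one_ne_zero
  have hφ := h1.continuous
  have hci : ∀ i, Continuous fun x => φ x i := fun i => by fun_prop
  have hc1 : ∀ i, ContDiff ℝ 1 fun x => φ x i := fun i => contDiff_euclidean.1 h1 i
  have hci' : ∀ i, Continuous fun x => fderiv ℝ (fun y => φ y i) x (EuclideanSpace.single i 1) :=
    fun i => ((hc1 i).continuous_fderiv one_ne_zero).clm_apply continuous_const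
  have hs : ∀ i, HasCompactSupport fun x => φ x i := fun i =>
    h2.comp_left (g := fun v : EuclideanSpace ℝ (Fin n) => v i) rfl
  have hs' : ∀ i, HasCompactSupport fun x =>
      fderiv ℝ (fun y => φ y i) x (EuclideanSpace.single i 1) := fun i => (hs i).fderiv_apply ℝ _
  have hi1 : ∀ i, Integrable fun x =>
      f x * fderiv ℝ (fun y => φ y i) x (EuclideanSpace.single i 1) := fun i =>
    (hfc.mul (hci' i)).integrable_of_hasCompactSupport (hs' i).mul_left
  have hi2 : ∀ i, Integrable fun x => fderiv ℝ f x (EuclideanSpace.single i 1) * φ x i := fun i =>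
    ((hf'.clm_apply continuous_const).mul (hci i)).integrable_of_hasCompactSupport (hs i).mul_left
  have hi3 : ∀ i, Integrable fun x => f x * φ x i := fun i =>
    (hfc.mul (hci i)).integrable_of_hasCompactSupport (hs i).mul_left
  calc ∫ x, f x * divergence φ x
      = ∫ x, ∑ i, f x * fderiv ℝ (fun y => φ y i) x (EuclideanSpace.single i 1) := by
        refine integral_congr_ae (Eventually.of_forall fun x => ?_)
        simp only [divergence, Finset.mul_sum,
          fderiv_euclidean_apply (h1.differentiable one_ne_zero x)]
    _ = ∑ i, ∫ x, f x * fderiv ℝ (fun y => φ y i) x (EuclideanSpace.single i 1) :=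
        integral_finsetSum _ fun i _ => hi1 i
    _ = ∑ i, -∫ x, fderiv ℝ f x (EuclideanSpace.single i 1) * φ x i :=
        Finset.sum_congr rfl fun i _ => integral_mul_fderiv_eq_neg_fderiv_mul_of_integrable
          (hi2 i) (hi1 i) (hi3 i) (fun x _ => hf.differentiable one_ne_zero x)
          (fun x _ => (hc1 i).differentiable one_ne_zero x)
    _ = - ∫ x, fderiv ℝ f x (φ x) := by
        rw [Finset.sum_neg_distrib, ← integral_finsetSum _ fun i _ => hi2 i]
        simp only [← apply_eq_sum]

open scoped Convolution

/-- By Fubini the pairing is a `ρ`-average of pairings of the indicator with translates of `φ`, each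
of which is again admissible in the definition of the perimeter. -/
theorem ofReal_integral_convolution_mul_divergence_le {E : Set (EuclideanSpace ℝ (Fin n))}
    (hE : MeasurableSet E) {ρ : EuclideanSpace ℝ (Fin n) → ℝ}
    (hρ : Continuous ρ) (hρc : HasCompactSupport ρ) (hρ0 : ∀ x, 0 ≤ ρ x) (hρ1 : ∫ x, ρ x = 1)
    {φ : EuclideanSpace ℝ (Fin n) → EuclideanSpace ℝ (Fin n)} (h1 : ContDiff ℝ 1 φ)
    (h2 : HasCompactSupport φ) (h3 : ∀ x, ‖φ x‖ ≤ 1) :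
    ENNReal.ofReal (∫ x, (ρ ⋆[ContinuousLinearMap.lsmul ℝ ℝ, volume] E.indicator 1) x
      * divergence φ x) ≤ perimeter E := by
  rcases eq_or_ne (perimeter E) ∞ with hP | hP
  · rw [hP]; exact le_top
  set g := divergence φ with hg
  have hgi : Integrable g := (continuous_divergence h1).integrable_of_hasCompactSupport
    (hasCompactSupport_divergence h2)
  have hρi : Integrable ρ := hρ.integrable_of_hasCompactSupport hρc
  have hfm : Measurable (E.indicator (1 : EuclideanSpace ℝ (Fin n) → ℝ)) :=
    measurable_one.indicator hE
  have hfb : ∀ x, ‖E.indicator (1 : EuclideanSpace ℝ (Fin n) → ℝ) x‖ ≤ 1 := fun x => by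
    by_cases hx : x ∈ E <;> simp [hx]
  have hprod : Integrable (fun p : EuclideanSpace ℝ (Fin n) × EuclideanSpace ℝ (Fin n) =>
      E.indicator (1 : EuclideanSpace ℝ (Fin n) → ℝ) (p.1 - p.2) * (g p.1 * ρ p.2))
      (volume.prod volume) :=
    (hgi.mul_prod hρi).bdd_mul (c := 1)
      (hfm.comp (measurable_fst.sub measurable_snd)).aestronglyMeasurable
      (Eventually.of_forall fun p => hfb _)
  have hshift : ∀ y, ∫ x, E.indicator (1 : EuclideanSpace ℝ (Fin n) → ℝ) (x - y) * g x
      ≤ (perimeter E).toReal := fun y => by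
    have e1 : ∫ x, E.indicator (1 : EuclideanSpace ℝ (Fin n) → ℝ) (x - y) * g x
        = ∫ x in E, divergence (fun x => φ (x + y)) x := by
      rw [← integral_indicator hE, ← integral_add_right_eq_self _ y]
      refine integral_congr_ae (Eventually.of_forall fun x => ?_)
      by_cases hx : x ∈ E
      · simp only [add_sub_cancel_right, hx, Set.indicator_of_mem, Pi.one_apply, one_mul, hg,
          divergence, fderiv_comp_add_right]
      · simp [hx]
    rw [e1]
    refine (ENNReal.ofReal_le_iff_le_toReal hP).1
      (ofReal_integral_divergence_le_perimeter E (h1.comp (contDiff_id.add contDiff_const))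
        (h2.comp_homeomorph (Homeomorph.addRight y)) fun x => h3 _)
  refine (ENNReal.ofReal_le_iff_le_toReal hP).2 ?_
  calc ∫ x, (ρ ⋆[ContinuousLinearMap.lsmul ℝ ℝ, volume] E.indicator 1) x * g x
      = ∫ x, ∫ y, E.indicator (1 : EuclideanSpace ℝ (Fin n) → ℝ) (x - y) * (g x * ρ y) := by
        refine integral_congr_ae (Eventually.of_forall fun x => ?_)
        simp only [convolution_def, ContinuousLinearMap.lsmul_apply, smul_eq_mul]
        rw [← integral_mul_const]
        congr 1; ext y; ring
    _ = ∫ y, ∫ x, E.indicator (1 : EuclideanSpace ℝ (Fin n) → ℝ) (x - y) * (g x * ρ y) :=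
        integral_integral_swap hprod
    _ = ∫ y, ρ y * ∫ x, E.indicator (1 : EuclideanSpace ℝ (Fin n) → ℝ) (x - y) * g x := by
        congr 1; ext y
        rw [← integral_const_mul]
        congr 1; ext x; ring
    _ ≤ ∫ y, ρ y * (perimeter E).toReal := by
        refine integral_mono ?_ (hρi.mul_const _) fun y =>
          mul_le_mul_of_nonneg_left (hshift y) (hρ0 y)
        refine hprod.swap.integral_prod_left.congr (Eventually.of_forall fun y => ?_)
        simp only [Function.comp, Prod.swap, ← integral_const_mul]
        congr 1; ext x; ring
    _ = (perimeter E).toReal := by rw [integral_mul_const, hρ1, one_mul]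

/-- The optimal field `-∇u / |∇u|` is not smooth where the gradient vanishes. It is replaced by `-∇u
/ √(δ² + |∇u|²)`, which is `C¹` because `u` is `C²`. Fatou's lemma removes `δ = 1/(m+1)`. -/
theorem lintegral_enorm_fderiv_le {u : EuclideanSpace ℝ (Fin n) → ℝ} (hu : ContDiff ℝ 2 u)
    (huc : HasCompactSupport u) {P : ℝ≥0∞}
    (h : ∀ φ : EuclideanSpace ℝ (Fin n) → EuclideanSpace ℝ (Fin n), ContDiff ℝ 1 φ →
      HasCompactSupport φ → (∀ x, ‖φ x‖ ≤ 1) →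
      ENNReal.ofReal (∫ x, u x * divergence φ x) ≤ P) :
    ∫⁻ x, ‖fderiv ℝ u x‖ₑ ≤ P := by
  set D : EuclideanSpace ℝ (Fin n) → EuclideanSpace ℝ (Fin n) :=
    fun x => dualVector (fderiv ℝ u x) with hD
  have hu1 : ContDiff ℝ 1 (fderiv ℝ u) := hu.fderiv_right (by norm_num)
  have hD1 : ContDiff ℝ 1 D := contDiff_euclidean.2 fun i => by
    simpa [hD, dualVector] using hu1.clm_apply contDiff_const
  have hDc : HasCompactSupport D :=
    (huc.fderiv ℝ).comp_left (g := dualVector) (by ext i; simp [dualVector])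
  have hDn : ∀ x, ‖D x‖ = ‖fderiv ℝ u x‖ := fun x => norm_dualVector _
  have hpos : ∀ (m : ℕ) x, 0 < (1 / ((m : ℝ) + 1)) ^ 2 + ‖D x‖ ^ 2 := fun m x => by positivity
  have key : ∀ m : ℕ, ∫⁻ x, ENNReal.ofReal
      ((√((1 / ((m : ℝ) + 1)) ^ 2 + ‖D x‖ ^ 2))⁻¹ * ‖D x‖ ^ 2) ≤ P := fun m => by
    set c : EuclideanSpace ℝ (Fin n) → ℝ :=
      fun x => (√((1 / ((m : ℝ) + 1)) ^ 2 + ‖D x‖ ^ 2))⁻¹ with hc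
    have hc1 : ContDiff ℝ 1 c :=
      ((contDiff_const.add (hD1.norm_sq ℝ)).sqrt fun x => (hpos m x).ne').inv
        fun x => (Real.sqrt_pos.2 (hpos m x)).ne'
    have hc0 : ∀ x, 0 ≤ c x := fun x => by positivity
    have hφ1 : ContDiff ℝ 1 fun x => -(c x • D x) := (hc1.smul hD1).neg
    have hφc : HasCompactSupport fun x => -(c x • D x) := (hDc.smul_left (f := c)).neg
    have hφn : ∀ x, ‖-(c x • D x)‖ ≤ 1 := fun x => by
      rw [norm_neg, norm_smul, Real.norm_of_nonneg (hc0 x), hc, inv_mul_le_one₀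
        (Real.sqrt_pos.2 (hpos m x))]
      exact Real.le_sqrt_of_sq_le (le_add_of_nonneg_left (sq_nonneg _))
    have := h _ hφ1 hφc hφn
    rw [integral_mul_divergence (hu.of_le (by norm_num)) hφ1 hφc, ← integral_neg] at this
    have e : ∀ x, -(fderiv ℝ u x (-(c x • D x))) = c x * ‖D x‖ ^ 2 := fun x => by
      rw [map_neg, neg_neg, map_smul, hDn, hD, apply_dualVector, smul_eq_mul]
    simp only [e] at this
    rwa [ofReal_integral_eq_lintegral_ofReal] at this
    · refine (hc1.continuous.mul (hD1.continuous.norm.pow 2)).integrable_of_hasCompactSupport ?_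
      refine hDc.mono fun x hx => ?_
      rw [Function.mem_support] at hx ⊢
      intro h0
      exact hx (by simp [h0])
    · exact Eventually.of_forall fun x => mul_nonneg (hc0 x) (sq_nonneg _)
  have hlim : ∀ x, Tendsto (fun m : ℕ => ENNReal.ofReal
      ((√((1 / ((m : ℝ) + 1)) ^ 2 + ‖D x‖ ^ 2))⁻¹ * ‖D x‖ ^ 2)) atTop (𝓝 ‖fderiv ℝ u x‖ₑ) := by
    intro x
    rw [← ofReal_norm, ← hDn]
    refine ENNReal.tendsto_ofReal ?_
    rcases eq_or_ne (D x) 0 with h0 | h0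
    · simp [h0]
    have hn : 0 < ‖D x‖ := norm_pos_iff.2 h0
    have t1 : Tendsto (fun m : ℕ => (1 / ((m : ℝ) + 1)) ^ 2 + ‖D x‖ ^ 2) atTop
        (𝓝 (0 ^ 2 + ‖D x‖ ^ 2)) :=
      (tendsto_one_div_add_atTop_nhds_zero_nat.pow 2).add_const _
    have t2 := ((t1.sqrt).inv₀ (by simp [h0])).mul_const (‖D x‖ ^ 2)
    convert t2 using 2
    rw [zero_pow two_ne_zero, zero_add, Real.sqrt_sq hn.le]
    field_simp
  calc ∫⁻ x, ‖fderiv ℝ u x‖ₑ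
      = ∫⁻ x, liminf (fun m : ℕ => ENNReal.ofReal
          ((√((1 / ((m : ℝ) + 1)) ^ 2 + ‖D x‖ ^ 2))⁻¹ * ‖D x‖ ^ 2)) atTop :=
        lintegral_congr fun x => (hlim x).liminf_eq.symm
    _ ≤ liminf (fun m : ℕ => ∫⁻ x, ENNReal.ofReal
          ((√((1 / ((m : ℝ) + 1)) ^ 2 + ‖D x‖ ^ 2))⁻¹ * ‖D x‖ ^ 2)) atTop :=
        lintegral_liminf_le fun m => by
          have := hD1.continuous.measurable
          fun_prop
    _ ≤ P := liminf_le_of_le (by isBoundedDefault) fun b hb => by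
        obtain ⟨m, hm⟩ := hb.exists
        exact hm.trans (key m)

theorem ofReal_integral_mul_divergence_le {u : EuclideanSpace ℝ (Fin n) → ℝ}
    (hu : ContDiff ℝ 1 u) {φ : EuclideanSpace ℝ (Fin n) → EuclideanSpace ℝ (Fin n)}
    (h1 : ContDiff ℝ 1 φ) (h2 : HasCompactSupport φ) (h3 : ∀ x, ‖φ x‖ ≤ 1) :
    ENNReal.ofReal (∫ x, u x * divergence φ x) ≤ ∫⁻ x, ‖fderiv ℝ u x‖ₑ := by
  rw [integral_mul_divergence hu h1 h2, ← integral_neg]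
  calc ENNReal.ofReal (∫ x, -(fderiv ℝ u x (φ x)))
      ≤ ‖∫ x, -(fderiv ℝ u x (φ x))‖ₑ := by
        rw [← ofReal_norm]
        exact ENNReal.ofReal_le_ofReal (le_abs_self _)
    _ ≤ ∫⁻ x, ‖-(fderiv ℝ u x (φ x))‖ₑ := enorm_integral_le_lintegral_enorm _
    _ ≤ ∫⁻ x, ‖fderiv ℝ u x‖ₑ := lintegral_mono fun x => by
        rw [enorm_neg, ← ofReal_norm, ← ofReal_norm]
        refine ENNReal.ofReal_le_ofReal (((fderiv ℝ u x).le_opNorm _).trans ?_)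
        exact mul_le_of_le_one_right (norm_nonneg _) (h3 x)

/-- Use the normalization `hN` with `L = fderiv ℝ u x` at each point, then Tonelli. -/
theorem lintegral_enorm_fderiv_eq {k : EuclideanSpace ℝ (Fin n) → ℝ≥0∞} (hk : Measurable k)
    (hN : ∀ L : EuclideanSpace ℝ (Fin n) →L[ℝ] ℝ, ∫⁻ z, k z * ‖L z‖ₑ = ‖L‖ₑ)
    {u : EuclideanSpace ℝ (Fin n) → ℝ} (hu : ContDiff ℝ 1 u) :
    ∫⁻ x, ‖fderiv ℝ u x‖ₑ = ∫⁻ z, k z * ∫⁻ x, ‖fderiv ℝ u x z‖ₑ := by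
  have hc : Continuous fun p : EuclideanSpace ℝ (Fin n) × EuclideanSpace ℝ (Fin n) =>
      fderiv ℝ u p.1 p.2 :=
    ((hu.continuous_fderiv one_ne_zero).comp continuous_fst).clm_apply continuous_snd
  have hm := hc.measurable
  calc ∫⁻ x, ‖fderiv ℝ u x‖ₑ = ∫⁻ x, ∫⁻ z, k z * ‖fderiv ℝ u x z‖ₑ := by simp only [hN]
    _ = ∫⁻ z, ∫⁻ x, k z * ‖fderiv ℝ u x z‖ₑ :=
        lintegral_lintegral_swap ((hk.comp measurable_snd).mul hm.enorm).aemeasurable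
    _ = _ := by
        refine lintegral_congr fun z => lintegral_const_mul _ ?_
        exact (hm.comp (measurable_id.prodMk measurable_const)).enorm

theorem ENNReal.mul_liminf_le (c : ℝ≥0∞) (a : ℕ → ℝ≥0∞) :
    c * liminf a atTop ≤ liminf (fun j => c * a j) atTop := by
  rw [liminf_eq_iSup_iInf_of_nat, liminf_eq_iSup_iInf_of_nat, ENNReal.mul_iSup]
  exact iSup_mono fun i => le_iInf₂ fun j hj => mul_le_mul_right (iInf₂_le j hj) _

/-- A shrinking sequence of bump functions. -/
def bumpSeq (V : Type*) [NormedAddCommGroup V] (j : ℕ) : ContDiffBump (0 : V) where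
  rIn := 1 / ((j : ℝ) + 1)
  rOut := 2 * (1 / ((j : ℝ) + 1))
  rIn_pos := by positivity
  rIn_lt_rOut := by linarith [show (0 : ℝ) < 1 / ((j : ℝ) + 1) by positivity]

/-- The perimeter of a bounded set is the average, against a kernel normalized by `hN`, of its
directional variations. -/
theorem perimeter_eq_lintegral_dirVar {k : EuclideanSpace ℝ (Fin n) → ℝ≥0∞} (hk : Measurable k)
    (hN : ∀ L : EuclideanSpace ℝ (Fin n) →L[ℝ] ℝ, ∫⁻ z, k z * ‖L z‖ₑ = ‖L‖ₑ)
    {E : Set (EuclideanSpace ℝ (Fin n))} (hE : MeasurableSet E) (hb : Bornology.IsBounded E) :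
    perimeter E = ∫⁻ z, k z * dirVar (E.indicator 1) z := by
  set f : EuclideanSpace ℝ (Fin n) → ℝ := E.indicator 1 with hf
  have hfm : Measurable f := measurable_one.indicator hE
  have hfi : Integrable f := (integrable_indicator_iff hE).2
    (integrableOn_const hb.measure_lt_top.ne)
  have hfb : ∀ x, ‖f x‖ ≤ 1 := fun x => by by_cases hx : x ∈ E <;> simp [hf, hx]
  have hfc : HasCompactSupport f :=
    HasCompactSupport.of_support_subset_isCompact hb.isCompact_closure
      ((Set.support_indicator_subset).trans subset_closure)
  set ρ : ℕ → EuclideanSpace ℝ (Fin n) → ℝ := fun j => (bumpSeq _ j).normed volume with hρ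
  set u : ℕ → EuclideanSpace ℝ (Fin n) → ℝ :=
    fun j => ρ j ⋆[ContinuousLinearMap.lsmul ℝ ℝ, volume] f with hu
  have hρc : ∀ j, Continuous (ρ j) := fun j => ContDiffBump.continuous_normed _
  have hρs : ∀ j, HasCompactSupport (ρ j) := fun j => ContDiffBump.hasCompactSupport_normed _
  have hρ0 : ∀ j x, 0 ≤ ρ j x := fun j => ContDiffBump.nonneg_normed _
  have hρ1 : ∀ j, ∫ x, ρ j x = 1 := fun j => ContDiffBump.integral_normed _
  have huC : ∀ j, ContDiff ℝ 2 (u j) := fun j => (hρs j).contDiff_convolution_left _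
    (ContDiffBump.contDiff_normed (n := 2) _) hfi.locallyIntegrable
  have hus : ∀ j, HasCompactSupport (u j) := fun j => (hρs j).convolution _ hfc
  have hum : ∀ j, Measurable (u j) := fun j => (huC j).continuous.measurable
  have hub : ∀ j x, ‖u j x‖ ≤ 1 := fun j x => by
    rw [hu, ← hρ1 j]
    simp only [convolution_def]
    refine norm_integral_le_of_norm_le ((hρc j).integrable_of_hasCompactSupport (hρs j))
      (Eventually.of_forall fun y => ?_)
    simp only [ContinuousLinearMap.lsmul_apply, smul_eq_mul, norm_mul,
      Real.norm_of_nonneg (hρ0 j y)]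
    exact mul_le_of_le_one_right (hρ0 j y) (hfb _)
  have hlim : ∀ᵐ x, Tendsto (fun j => u j x) atTop (𝓝 (f x)) := by
    -- `K = 2` is the ratio of outer to inner radius in `bumpSeq`.
    refine ContDiffBump.ae_convolution_tendsto_right_of_locallyIntegrable (K := 2) ?_
      (Eventually.of_forall fun j => le_rfl) hfi.locallyIntegrable
    simpa [bumpSeq] using
      (tendsto_one_div_add_atTop_nhds_zero_nat (𝕜 := ℝ)).const_mul 2
  have htm := measurable_transDiff hfm
  apply le_antisymm
  -- Upper bound: for a fixed test field, pass to the limit in the mollified pairings; mollification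
  -- does not increase `dirVar`.
  · refine iSup_le fun φ => iSup_le fun h1 => iSup_le fun h2 => iSup_le fun h3 => ?_
    have hgi : Integrable (divergence φ) := (continuous_divergence h1).integrable_of_hasCompactSupport
      (hasCompactSupport_divergence h2)
    have t1 : Tendsto (fun j => ∫ x, u j x * divergence φ x) atTop
        (𝓝 (∫ x, f x * divergence φ x)) := by
      refine tendsto_integral_of_dominated_convergence (fun x => ‖divergence φ x‖)
        (fun j => ((hum j).aestronglyMeasurable.mul hgi.aestronglyMeasurable)) hgi.norm
        (fun j => Eventually.of_forall fun x => ?_) ?_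
      · rw [norm_mul]
        exact mul_le_of_le_one_left (norm_nonneg _) (hub j x)
      · filter_upwards [hlim] with x hx using hx.mul_const _
    have e1 : ∫ x in E, divergence φ x = ∫ x, f x * divergence φ x := by
      rw [← integral_indicator hE]
      refine integral_congr_ae (Eventually.of_forall fun x => ?_)
      by_cases hx : x ∈ E <;> simp [hf, hx]
    rw [e1]
    refine le_of_tendsto (ENNReal.tendsto_ofReal t1) (Eventually.of_forall fun j => ?_)
    refine (ofReal_integral_mul_divergence_le ((huC j).of_le (by norm_num)) h1 h2 h3).trans ?_
    rw [lintegral_enorm_fderiv_eq hk hN ((huC j).of_le (by norm_num))]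
    refine lintegral_mono fun z => mul_le_mul_right ?_ _
    refine (lintegral_fderiv_le_dirVar ((huC j).differentiable (by norm_num)) z).trans ?_
    exact iSup_mono fun m => mul_le_mul_right (transDiff_convolution_le (hρc j) (hρs j) (hρ0 j)
      (hρ1 j) hfm hfi _) _
  · have hP : ∀ j, ∫⁻ x, ‖fderiv ℝ (u j) x‖ₑ ≤ perimeter E := fun j =>
      lintegral_enorm_fderiv_le (huC j) (hus j) fun φ h1 h2 h3 =>
        ofReal_integral_convolution_mul_divergence_le hE (hρc j) (hρs j) (hρ0 j) (hρ1 j) h1 h2 h3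
    -- Lower bound: at a fixed dyadic scale, Fatou in the mollification parameter gives a bound
    -- independent of `m`. Monotone convergence in `m` then recovers `dirVar`.
    have hstep : ∀ m : ℕ, ∫⁻ z, k z * (2 ^ m * transDiff f (((2 : ℝ) ^ m)⁻¹ • z))
        ≤ perimeter E := fun m => by
      calc ∫⁻ z, k z * (2 ^ m * transDiff f (((2 : ℝ) ^ m)⁻¹ • z))
          ≤ ∫⁻ z, liminf (fun j => k z * (2 ^ m * transDiff (u j) (((2 : ℝ) ^ m)⁻¹ • z))) atTop := by
            refine lintegral_mono fun z => ?_
            refine le_trans ?_ (ENNReal.mul_liminf_le _ _)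
            refine mul_le_mul_right (le_trans ?_ (ENNReal.mul_liminf_le _ _)) _
            exact mul_le_mul_right (transDiff_le_liminf hum hlim _) _
        _ ≤ liminf (fun j => ∫⁻ z, k z * (2 ^ m * transDiff (u j) (((2 : ℝ) ^ m)⁻¹ • z))) atTop :=
            lintegral_liminf_le fun j => hk.mul
              (((measurable_transDiff (hum j)).comp (measurable_const_smul _)).const_mul _)
        _ ≤ perimeter E := liminf_le_of_le (by isBoundedDefault) fun b hb => by
            obtain ⟨j, hj⟩ := hb.exists
            refine hj.trans (le_trans ?_ (hP j))
            rw [lintegral_enorm_fderiv_eq hk hN ((huC j).of_le (by norm_num))]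
            refine lintegral_mono fun z => mul_le_mul_right ?_ _
            refine (mul_le_mul_right (transDiff_le_lintegral_fderiv
              ((huC j).of_le (by norm_num)) _) _).trans (le_of_eq ?_)
            rw [← lintegral_const_mul' _ _ (by simp)]
            refine lintegral_congr fun x => ?_
            rw [two_pow_mul_enorm, map_smul, smul_eq_mul, mul_inv_cancel_left₀ (by positivity)]
    have e2 : ∀ z, k z * dirVar f z
        = ⨆ m : ℕ, k z * (2 ^ m * transDiff f (((2 : ℝ) ^ m)⁻¹ • z)) := fun z => by
      rw [dirVar, ENNReal.mul_iSup]
    simp only [e2]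
    rw [lintegral_iSup]
    · exact iSup_le hstep
    · exact fun m => hk.mul ((htm.comp (measurable_const_smul _)).const_mul _)
    · exact fun a b hab z => mul_le_mul_right (transDiff_dyadic_monotone hfm z hab) _

end Perimeter

/-- The factor `2` is spent on symmetrizing: since `k` is even, the integrand plus its swap is `k (x
- y) * |f x - f y|`. Then substitute `x = y + z`. -/
theorem nonlocalPerimeter_eq_lintegral_transDiff {n : ℕ} {K : EuclideanSpace ℝ (Fin n) → ℝ}
    {k : EuclideanSpace ℝ (Fin n) → ℝ≥0∞} (hk : Measurable k) (hneg : ∀ z, k (-z) = k z)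
    (hK : ∀ᵐ z, ENNReal.ofReal (K z) = k z) {E F : Set (EuclideanSpace ℝ (Fin n))}
    (hF : MeasurableSet F) (hEF : E =ᵐ[volume] F) :
    nonlocalPerimeter K E = ∫⁻ z, k z * transDiff (F.indicator 1) z := by
  set f : EuclideanSpace ℝ (Fin n) → ℝ := F.indicator 1 with hf
  have hfm : Measurable f := measurable_one.indicator hF
  set g : EuclideanSpace ℝ (Fin n) → EuclideanSpace ℝ (Fin n) → ℝ≥0∞ := fun x y =>
    F.indicator 1 x * (Fᶜ.indicator 1 y * k (x - y)) with hg
  have hgm : Measurable (Function.uncurry g) := by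
    have h1 : Measurable (F.indicator (1 : EuclideanSpace ℝ (Fin n) → ℝ≥0∞)) :=
      measurable_one.indicator hF
    have h2 : Measurable (Fᶜ.indicator (1 : EuclideanSpace ℝ (Fin n) → ℝ≥0∞)) :=
      measurable_one.indicator hF.compl
    exact (h1.comp measurable_fst).mul ((h2.comp measurable_snd).mul
      (hk.comp (measurable_fst.sub measurable_snd)))
  have e1 : ∫⁻ x in E, ∫⁻ y in Eᶜ, ENNReal.ofReal (K (x - y)) = ∫⁻ x, ∫⁻ y, g x y := by
    rw [setLIntegral_congr hEF, ← lintegral_indicator hF]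
    refine lintegral_congr fun x => ?_
    by_cases hx : x ∈ F
    · rw [Set.indicator_of_mem hx, setLIntegral_congr hEF.compl, ← lintegral_indicator hF.compl]
      have hae : ∀ᵐ y, ENNReal.ofReal (K (x - y)) = k (x - y) :=
        (quasiMeasurePreserving_sub_left volume x).ae hK
      refine lintegral_congr_ae ?_
      filter_upwards [hae] with y hy
      by_cases hy' : y ∈ F <;> simp [hg, hx, hy', hy]
    · simp [hg, hx]
  have e2 : ∫⁻ x, ∫⁻ y, g x y = ∫⁻ x, ∫⁻ y, g y x := lintegral_lintegral_swap hgm.aemeasurable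
  have hpt : ∀ x y, g x y + g y x = k (x - y) * ‖f x - f y‖ₑ := fun x y => by
    have : k (y - x) = k (x - y) := by rw [← hneg, neg_sub]
    by_cases hx : x ∈ F <;> by_cases hy : y ∈ F <;> simp [hg, hf, hx, hy, this]
  calc nonlocalPerimeter K E = (∫⁻ x, ∫⁻ y, g x y) + ∫⁻ x, ∫⁻ y, g y x := by
        rw [nonlocalPerimeter, e1, two_mul, ← e2]
    _ = ∫⁻ x, ∫⁻ y, k (x - y) * ‖f x - f y‖ₑ := by
        rw [← lintegral_add_left (show Measurable fun x => ∫⁻ y, g x y from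
          hgm.lintegral_prod_right')]
        refine lintegral_congr fun x => ?_
        rw [← lintegral_add_left (show Measurable (g x) from hgm.comp measurable_prodMk_left)]
        simp only [← hpt]
    _ = ∫⁻ y, ∫⁻ x, k (x - y) * ‖f x - f y‖ₑ := lintegral_lintegral_swap (by fun_prop)
    _ = ∫⁻ y, ∫⁻ z, k z * ‖f (y + z) - f y‖ₑ := by
        refine lintegral_congr fun y => ?_
        rw [← lintegral_add_right_eq_self _ y]
        simp only [add_sub_cancel_right, add_comm y]
    _ = ∫⁻ z, ∫⁻ y, k z * ‖f (y + z) - f y‖ₑ := lintegral_lintegral_swap (by fun_prop)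
    _ = _ := lintegral_congr fun z => lintegral_const_mul _ (by fun_prop)

/-! ### The one-dimensional inequality. -/

section Line

theorem setLIntegral_Ioc_comp_add (g : ℝ → ℝ≥0∞) (a b c : ℝ) :
    ∫⁻ x in Set.Ioc a b, g (x + c) = ∫⁻ x in Set.Ioc (a + c) (b + c), g x := by
  rw [← lintegral_indicator measurableSet_Ioc, ← lintegral_indicator measurableSet_Ioc,
    ← lintegral_add_right_eq_self (Set.indicator (Set.Ioc (a + c) (b + c)) g) c]
  refine lintegral_congr fun x => ?_
  simp only [Set.indicator_apply, Set.mem_Ioc, add_lt_add_iff_right, add_le_add_iff_right]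

/-- Telescope along `x, x + t, …, x + m t`: as `x` runs through one window of length `t`, the
shifted windows tile `(a, a + m t]`. -/
theorem setLIntegral_enorm_le_add_right {f : ℝ → ℝ} (hf : Measurable f) (a : ℝ) {t : ℝ}
    (ht : 0 ≤ t) (m : ℕ) :
    ∫⁻ x in Set.Ioc a (a + t), ‖f x‖ₑ ≤ (∫⁻ x in Set.Ioc a (a + t), ‖f (x + m * t)‖ₑ)
      + ∫⁻ x in Set.Ioc a (a + m * t), ‖f (x + t) - f x‖ₑ := by
  induction m with
  | zero => simp
  | succ m ih =>
    have e1 : ∫⁻ x in Set.Ioc a (a + t), ‖f (x + m * t)‖ₑ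
        ≤ (∫⁻ x in Set.Ioc a (a + t), ‖f (x + (m + 1 : ℕ) * t)‖ₑ)
          + ∫⁻ x in Set.Ioc a (a + t), ‖f (x + m * t + t) - f (x + m * t)‖ₑ := by
      rw [← lintegral_add_left (by fun_prop)]
      refine lintegral_mono fun x => ?_
      have : x + (m + 1 : ℕ) * t = x + m * t + t := by push_cast; ring
      rw [this, ← enorm_neg (f (x + m * t + t) - f (x + m * t))]
      refine le_trans (le_of_eq ?_) (enorm_add_le _ _)
      congr 1; ring
    have e2 : ∫⁻ x in Set.Ioc a (a + t), ‖f (x + m * t + t) - f (x + m * t)‖ₑ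
        = ∫⁻ x in Set.Ioc (a + m * t) (a + (m + 1 : ℕ) * t), ‖f (x + t) - f x‖ₑ := by
      rw [setLIntegral_Ioc_comp_add (fun x => ‖f (x + t) - f x‖ₑ)]
      congr 3; push_cast; ring
    have e3 : ∫⁻ x in Set.Ioc a (a + (m + 1 : ℕ) * t), ‖f (x + t) - f x‖ₑ
        = (∫⁻ x in Set.Ioc a (a + m * t), ‖f (x + t) - f x‖ₑ)
          + ∫⁻ x in Set.Ioc (a + m * t) (a + (m + 1 : ℕ) * t), ‖f (x + t) - f x‖ₑ := by
      rw [← lintegral_union measurableSet_Ioc (Set.Ioc_disjoint_Ioc_of_le le_rfl),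
        Set.Ioc_union_Ioc_eq_Ioc]
      · have : 0 ≤ m * t := by positivity
        linarith
      · push_cast; linarith
    calc _ ≤ _ := ih
      _ ≤ _ := add_le_add_left e1 _
      _ = _ := by rw [e2, e3]; ring

theorem setLIntegral_enorm_le_add_left {f : ℝ → ℝ} (hf : Measurable f) (a : ℝ) {t : ℝ}
    (ht : 0 ≤ t) (m : ℕ) :
    ∫⁻ x in Set.Ioc a (a + t), ‖f x‖ₑ ≤ (∫⁻ x in Set.Ioc a (a + t), ‖f (x - m * t)‖ₑ)
      + ∫⁻ x in Set.Ioc (a - m * t) a, ‖f (x + t) - f x‖ₑ := by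
  induction m with
  | zero => simp
  | succ m ih =>
    have e1 : ∫⁻ x in Set.Ioc a (a + t), ‖f (x - m * t)‖ₑ
        ≤ (∫⁻ x in Set.Ioc a (a + t), ‖f (x - (m + 1 : ℕ) * t)‖ₑ)
          + ∫⁻ x in Set.Ioc a (a + t),
            ‖f (x + -((m + 1 : ℕ) * t) + t) - f (x + -((m + 1 : ℕ) * t))‖ₑ := by
      rw [← lintegral_add_left (by fun_prop)]
      refine lintegral_mono fun x => ?_
      have h1 : x + -((m + 1 : ℕ) * t) + t = x - m * t := by push_cast; ring
      have h2 : x + -((m + 1 : ℕ) * t) = x - (m + 1 : ℕ) * t := by ring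
      rw [h1, h2]
      refine le_trans (le_of_eq ?_) (enorm_add_le _ _)
      congr 1; ring
    have e2 : ∫⁻ x in Set.Ioc a (a + t),
          ‖f (x + -((m + 1 : ℕ) * t) + t) - f (x + -((m + 1 : ℕ) * t))‖ₑ
        = ∫⁻ x in Set.Ioc (a - (m + 1 : ℕ) * t) (a - m * t), ‖f (x + t) - f x‖ₑ := by
      rw [setLIntegral_Ioc_comp_add (fun x => ‖f (x + t) - f x‖ₑ)]
      congr 3; push_cast; ring
    have e3 : ∫⁻ x in Set.Ioc (a - (m + 1 : ℕ) * t) a, ‖f (x + t) - f x‖ₑ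
        = (∫⁻ x in Set.Ioc (a - (m + 1 : ℕ) * t) (a - m * t), ‖f (x + t) - f x‖ₑ)
          + ∫⁻ x in Set.Ioc (a - m * t) a, ‖f (x + t) - f x‖ₑ := by
      rw [← lintegral_union measurableSet_Ioc (Set.Ioc_disjoint_Ioc_of_le le_rfl),
        Set.Ioc_union_Ioc_eq_Ioc]
      · push_cast; linarith
      · have : 0 ≤ m * t := by positivity
        linarith
    calc _ ≤ _ := ih
      _ ≤ _ := add_le_add_left e1 _
      _ = _ := by rw [e2, e3]; ring

/-- Telescoping from the window out of the support, once to the right and once to the left, pays its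
mass twice, over disjoint ranges. -/
theorem two_mul_setLIntegral_le_transDiff {f : ℝ → ℝ} (hf : Measurable f) {R : ℝ}
    (hR : ∀ x, R < |x| → f x = 0) (a : ℝ) {t : ℝ} (ht : 0 < t) :
    2 * ∫⁻ x in Set.Ioc a (a + t), ‖f x‖ₑ ≤ transDiff f t := by
  -- With `m t > R + |a| + t`, both extreme translates of the window lie outside `[-R, R]`.
  obtain ⟨m, hm⟩ := exists_nat_gt ((R + |a| + t) / t)
  rw [div_lt_iff₀ ht] at hm
  have h1 := setLIntegral_enorm_le_add_right hf a ht.le m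
  have h2 := setLIntegral_enorm_le_add_left hf a ht.le m
  have ha := abs_le.1 (le_refl |a|)
  have z1 : ∫⁻ x in Set.Ioc a (a + t), ‖f (x + m * t)‖ₑ = 0 := by
    rw [setLIntegral_congr_fun measurableSet_Ioc (g := fun _ => 0), lintegral_zero]
    intro x hx
    have : f (x + m * t) = 0 := hR _ (lt_of_lt_of_le (by linarith [hx.1]) (le_abs_self _))
    simp [this]
  have z2 : ∫⁻ x in Set.Ioc a (a + t), ‖f (x - m * t)‖ₑ = 0 := by
    rw [setLIntegral_congr_fun measurableSet_Ioc (g := fun _ => 0), lintegral_zero]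
    intro x hx
    have : f (x - m * t) = 0 := hR _ (lt_of_lt_of_le (by linarith [hx.2]) (neg_le_abs _))
    simp [this]
  rw [z1, zero_add] at h1
  rw [z2, zero_add] at h2
  calc 2 * ∫⁻ x in Set.Ioc a (a + t), ‖f x‖ₑ
      ≤ (∫⁻ x in Set.Ioc (a - m * t) a, ‖f (x + t) - f x‖ₑ)
        + ∫⁻ x in Set.Ioc a (a + m * t), ‖f (x + t) - f x‖ₑ := by
        rw [two_mul]; exact add_le_add h2 h1
    _ = ∫⁻ x in Set.Ioc (a - m * t) a ∪ Set.Ioc a (a + m * t), ‖f (x + t) - f x‖ₑ :=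
        (lintegral_union measurableSet_Ioc (Set.Ioc_disjoint_Ioc_of_le le_rfl)).symm
    _ ≤ transDiff f t := setLIntegral_le_lintegral _ _

/-- A bounded set of positive measure has at least two jumps. Quantitatively, a window of length `r
/ 2 ^ n` centred at a density point `p` of `A` is almost filled by `A`, so
`two_mul_setLIntegral_le_transDiff` gives nearly `2r` after multiplication by `2 ^ n`. -/
theorem two_mul_ofReal_le_dirVar {A : Set ℝ} (hA : MeasurableSet A)
    (hb : Bornology.IsBounded A) (h0 : volume A ≠ 0) {r : ℝ} (hr : 0 < r) :
    2 * ENNReal.ofReal r ≤ dirVar (A.indicator 1) r := by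
  obtain ⟨R, hR⟩ := hb.exists_norm_le
  have hRz : ∀ x, R < |x| → A.indicator (1 : ℝ → ℝ) x = 0 := fun x hx =>
    Set.indicator_of_notMem (fun h => absurd (hR x h) (not_le.2 hx)) _
  have hfm : Measurable (A.indicator (1 : ℝ → ℝ)) := measurable_one.indicator hA
  have : (ae (volume.restrict A)).NeBot := ae_restrict_neBot.2 h0
  obtain ⟨p, hp⟩ := (Besicovitch.ae_tendsto_measure_inter_div volume A).exists
  -- Radii are half the dyadic step, so that the ball has the length of one window.
  have hδ : Tendsto (fun n : ℕ => r * ((2 : ℝ) ^ n)⁻¹ / 2) atTop (𝓝[>] 0) := by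
    refine tendsto_nhdsWithin_iff.2 ⟨?_, Eventually.of_forall fun n => ?_⟩
    · have := ((tendsto_pow_atTop_atTop_of_one_lt (one_lt_two (α := ℝ))).inv_tendsto_atTop).const_mul
        r |>.div_const 2
      simpa using this
    · exact Set.mem_Ioi.2 (by positivity)
  have hlim := ENNReal.Tendsto.const_mul (a := 2 * ENNReal.ofReal r) (hp.comp hδ)
    (Or.inr (by finiteness))
  rw [mul_one] at hlim
  refine le_of_tendsto hlim (Eventually.of_forall fun n => ?_)
  set t : ℝ := r * ((2 : ℝ) ^ n)⁻¹ with ht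
  have ht0 : 0 < t := by positivity
  have h1 := two_mul_setLIntegral_le_transDiff hfm hRz (p - t / 2) ht0
  have h2 : ∫⁻ x in Set.Ioc (p - t / 2) (p - t / 2 + t), ‖A.indicator (1 : ℝ → ℝ) x‖ₑ
      = volume (A ∩ closedBall p (t / 2)) := by
    have e : ∀ x, ‖A.indicator (1 : ℝ → ℝ) x‖ₑ = A.indicator (1 : ℝ → ℝ≥0∞) x := fun x => by
      by_cases hx : x ∈ A <;> simp [hx]
    simp only [e]
    rw [lintegral_indicator_one hA, Measure.restrict_apply hA, Real.closedBall_eq_Icc]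
    refine measure_congr ((ae_eq_refl A).inter ?_)
    rw [show p - t / 2 + t = p + t / 2 by ring]
    exact Ioc_ae_eq_Icc
  have h3 : (2 : ℝ≥0∞) ^ n * transDiff (A.indicator (1 : ℝ → ℝ)) (((2 : ℝ) ^ n)⁻¹ • r)
      ≤ dirVar (A.indicator 1) r :=
    le_iSup (fun n : ℕ => (2 : ℝ≥0∞) ^ n *
      transDiff (A.indicator (1 : ℝ → ℝ)) (((2 : ℝ) ^ n)⁻¹ • r)) n
  refine le_trans ?_ h3
  rw [smul_eq_mul, mul_comm _ r, ← ht]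
  refine le_trans (le_of_eq ?_) (mul_le_mul_right h1 _)
  rw [h2]
  simp only [Function.comp_apply]
  rw [Real.volume_closedBall, show 2 * (t / 2) = t by ring]
  have e4 : ENNReal.ofReal r = 2 ^ n * ENNReal.ofReal t := by
    rw [show (2 : ℝ≥0∞) ^ n = ENNReal.ofReal (2 ^ n) by
      rw [ENNReal.ofReal_pow zero_le_two]; simp, ← ENNReal.ofReal_mul (by positivity)]
    congr 1
    rw [ht]; field_simp
  rw [e4, show (2 : ℝ≥0∞) * (2 ^ n * ENNReal.ofReal t) *
    (volume (A ∩ closedBall p (t / 2)) / ENNReal.ofReal t)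
    = 2 ^ n * (2 * (ENNReal.ofReal t *
    (volume (A ∩ closedBall p (t / 2)) / ENNReal.ofReal t))) by ring,
    ENNReal.mul_div_cancel (by simpa using ht0) ENNReal.ofReal_ne_top]

theorem transDiff_indicator_Ico_le (a b : ℝ) {w : ℝ} (hw : 0 < w) :
    transDiff ((Set.Ico a b).indicator 1) w ≤ 2 * ENNReal.ofReal w := by
  calc transDiff ((Set.Ico a b).indicator 1) w
      ≤ ∫⁻ x, ((Set.Ico (a - w) a).indicator 1 x + (Set.Ico (b - w) b).indicator 1 x) := by
        refine lintegral_mono fun x => ?_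
        by_cases h1 : x + w ∈ Set.Ico a b <;> by_cases h2 : x ∈ Set.Ico a b
        · simp [h1, h2]
        · have : x ∈ Set.Ico (a - w) a := by
            simp only [Set.mem_Ico, not_and, not_lt] at *
            refine ⟨by linarith, ?_⟩
            by_contra! h
            linarith [h2 h]
          simp [h1, h2, this]
        · have : x ∈ Set.Ico (b - w) b := by
            simp only [Set.mem_Ico, not_and, not_lt] at *
            exact ⟨by linarith [h1 (by linarith)], h2.2⟩
          simp [h1, h2, this]
        · simp [h1, h2]
    _ = 2 * ENNReal.ofReal w := by
        rw [lintegral_add_left (measurable_one.indicator measurableSet_Ico),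
          lintegral_indicator_one measurableSet_Ico, lintegral_indicator_one measurableSet_Ico,
          Real.volume_Ico, Real.volume_Ico, two_mul]
        congr 2 <;> ring

/-- The two displayed pieces are the points entering and leaving the interval under the shift; they
are disjoint, each of length `min w (b - a)`. -/
theorem le_transDiff_indicator_Ico (a b w : ℝ) :
    2 * ENNReal.ofReal (min w (b - a)) ≤ transDiff ((Set.Ico a b).indicator 1) w := by
  calc 2 * ENNReal.ofReal (min w (b - a))
      = ∫⁻ x, ((Set.Ico (a - w) (min a (b - w))).indicator 1 x
          + (Set.Ico (max a (b - w)) b).indicator 1 x) := by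
        rw [lintegral_add_left (measurable_one.indicator measurableSet_Ico),
          lintegral_indicator_one measurableSet_Ico, lintegral_indicator_one measurableSet_Ico,
          Real.volume_Ico, Real.volume_Ico, two_mul]
        congr 2
        · rcases le_total a (b - w) with h | h
          · rw [min_eq_left h, min_eq_left (by linarith)]; ring
          · rw [min_eq_right h, min_eq_right (by linarith)]; ring
        · rcases le_total a (b - w) with h | h
          · rw [max_eq_right h, min_eq_left (by linarith)]; ring
          · rw [max_eq_left h, min_eq_right (by linarith)]
    _ ≤ _ := by
        refine lintegral_mono fun x => ?_
        by_cases h1 : x ∈ Set.Ico (a - w) (min a (b - w))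
        · have h2 : x ∉ Set.Ico (max a (b - w)) b := fun h => by
            have := (lt_min_iff.1 h1.2).1
            have := (max_le_iff.1 h.1).1
            linarith
          have h3 := lt_min_iff.1 h1.2
          have h4 : x + w ∈ Set.Ico a b := ⟨by linarith [h1.1], by linarith⟩
          have h5 : x ∉ Set.Ico a b := fun h => by linarith [h.1]
          simp [h1, h2, h4, h5]
        · by_cases h2 : x ∈ Set.Ico (max a (b - w)) b
          · have h3 := max_le_iff.1 h2.1
            have h4 : x + w ∉ Set.Ico a b := fun h => by linarith [h.2]
            have h5 : x ∈ Set.Ico a b := ⟨h3.1, h2.2⟩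
            simp [h1, h2, h4, h5]
          · simp [h1, h2]

theorem Set.OrdConnected.ae_eq_Ico {I : Set ℝ} (hI : I.OrdConnected) (hb : Bornology.IsBounded I)
    (hne : I.Nonempty) : I =ᵐ[volume] Set.Ico (sInf I) (sSup I) := by
  have h1 : Set.Ioo (sInf I) (sSup I) ⊆ I :=
    IsConnected.Ioo_csInf_csSup_subset ⟨hne, isPreconnected_iff_ordConnected.2 hI⟩
      hb.bddBelow hb.bddAbove
  have h2 : I ⊆ Set.Icc (sInf I) (sSup I) := subset_Icc_csInf_csSup hb.bddBelow hb.bddAbove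
  exact (h2.eventuallyLE.trans_eq Ico_ae_eq_Icc.symm).antisymm
    (Ioo_ae_eq_Ico.symm.trans_le h1.eventuallyLE)

/-- Filling a bounded subset of the line to an interval increases neither `dirVar` nor
`dirVar - transDiff`. -/
theorem dirVar_le_and_add_transDiff_le_of_ordConnected {A I : Set ℝ} (hA : MeasurableSet A)
    (hI : I.OrdConnected) (hb : Bornology.IsBounded I) (hAI : A ⊆ I)
    (h0 : volume I ≠ 0 → volume A ≠ 0) {r : ℝ} (hr : 0 < r) :
    dirVar (I.indicator 1) r ≤ dirVar (A.indicator 1) r ∧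
      dirVar (I.indicator 1) r + transDiff (A.indicator 1) r
        ≤ dirVar (A.indicator 1) r + transDiff (I.indicator 1) r := by
  have hAm : Measurable (A.indicator (1 : ℝ → ℝ)) := measurable_one.indicator hA
  by_cases hv : volume I = 0
  · have z1 : A.indicator (1 : ℝ → ℝ) =ᵐ[volume] 0 :=
      indicator_meas_zero (measure_mono_null hAI hv)
    have z2 : I.indicator (1 : ℝ → ℝ) =ᵐ[volume] 0 := indicator_meas_zero hv
    rw [dirVar_congr_ae z1, dirVar_congr_ae z2, transDiff_congr_ae z1, transDiff_congr_ae z2]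
    exact ⟨le_rfl, le_rfl⟩
  have hne : I.Nonempty := nonempty_of_measure_ne_zero hv
  have hIae := Set.OrdConnected.ae_eq_Ico hI hb hne
  have hIf : I.indicator (1 : ℝ → ℝ) =ᵐ[volume] (Set.Ico (sInf I) (sSup I)).indicator 1 :=
    indicator_ae_eq_of_ae_eq_set hIae
  set a := sInf I
  set b := sSup I
  rw [dirVar_congr_ae hIf, transDiff_congr_ae hIf]
  have hd : dirVar ((Set.Ico a b).indicator 1) r ≤ 2 * ENNReal.ofReal r := by
    refine iSup_le fun n => ?_
    refine (mul_le_mul_right (transDiff_indicator_Ico_le a b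
      (w := ((2 : ℝ) ^ n)⁻¹ • r) (by rw [smul_eq_mul]; positivity)) _).trans (le_of_eq ?_)
    rw [smul_eq_mul, ENNReal.ofReal_mul (by positivity), ENNReal.ofReal_inv_of_pos (by positivity),
      ENNReal.ofReal_pow zero_le_two, ENNReal.ofReal_ofNat, mul_left_comm,
      ENNReal.mul_inv_cancel_left (by simp) (by simp)]
  have hdA := hd.trans (two_mul_ofReal_le_dirVar hA (hb.subset hAI) (h0 hv) hr)
  refine ⟨hdA, ?_⟩
  have hl := le_transDiff_indicator_Ico a b r
  -- If `r` is at most the length, the interval satisfies `dirVar ≤ transDiff`, and `transDiff ≤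
  -- dirVar` always holds for `A`. Otherwise `transDiff` of `A` is at most `2|A| ≤ 2|I|`, which `I`
  -- attains.
  rcases le_total r (b - a) with h | h
  · rw [min_eq_left h] at hl
    rw [add_comm]
    exact add_le_add (transDiff_le_dirVar _ _) (hd.trans hl)
  · rw [min_eq_right h] at hl
    refine add_le_add hdA ?_
    refine (transDiff_le_two_mul hAm r).trans (le_trans (mul_le_mul_right ?_ _) hl)
    have e : ∀ x, ‖A.indicator (1 : ℝ → ℝ) x‖ₑ = A.indicator (1 : ℝ → ℝ≥0∞) x := fun x => by
      by_cases hx : x ∈ A <;> simp [hx]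
    simp only [e]
    rw [lintegral_indicator_one hA, ← Real.volume_Ico, ← measure_congr hIae]
    exact measure_mono hAI

end Line

/-! ### Slicing the plane by parallel lines. -/

section Slicing

/-- Cartesian coordinates on the plane attached to an orthonormal basis. -/
def planeMap (b : OrthonormalBasis (Fin 2) ℝ (EuclideanSpace ℝ (Fin 2))) (p : ℝ × ℝ) :
    EuclideanSpace ℝ (Fin 2) :=
  p.1 • b 0 + p.2 • b 1

variable (b : OrthonormalBasis (Fin 2) ℝ (EuclideanSpace ℝ (Fin 2)))

theorem continuous_planeMap : Continuous (planeMap b) := by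
  unfold planeMap
  fun_prop

theorem measurePreserving_planeMap : MeasurePreserving (planeMap b) := by
  have h := (b.measurePreserving_repr_symm.comp (PiLp.volume_preserving_toLp (Fin 2))).comp
    (volume_preserving_finTwoArrow ℝ).symm
  have e : planeMap b = (b.repr.symm ∘ WithLp.toLp 2) ∘ MeasurableEquiv.finTwoArrow.symm := by
    funext p
    simp [planeMap, ← OrthonormalBasis.sum_repr_symm, Fin.sum_univ_two]
  rw [e]
  exact h

theorem planeMap_inner (x : EuclideanSpace ℝ (Fin 2)) :
    planeMap b (inner ℝ (b 0) x, inner ℝ (b 1) x) = x := by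
  conv_rhs => rw [← b.sum_repr' x]
  simp [planeMap, Fin.sum_univ_two]

theorem inner_planeMap_zero (s t : ℝ) : inner ℝ (b 0) (planeMap b (s, t)) = s := by
  simp [planeMap, inner_add_right, inner_smul_right, b.inner_eq_ite]

theorem inner_planeMap_one (s t : ℝ) : inner ℝ (b 1) (planeMap b (s, t)) = t := by
  simp [planeMap, inner_add_right, inner_smul_right, b.inner_eq_ite]

theorem planeMap_add_smul (s t τ : ℝ) : planeMap b (s, t) + τ • b 1 = planeMap b (s, t + τ) := by
  simp only [planeMap]; module

theorem measurable_slice {f : EuclideanSpace ℝ (Fin 2) → ℝ} (hf : Measurable f) (s : ℝ) :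
    Measurable fun t => f (planeMap b (s, t)) :=
  hf.comp ((continuous_planeMap b).measurable.comp measurable_prodMk_left)

theorem measurable_transDiff_slice {f : EuclideanSpace ℝ (Fin 2) → ℝ} (hf : Measurable f) (τ : ℝ) :
    Measurable fun s => transDiff (fun t => f (planeMap b (s, t))) τ := by
  have h := (continuous_planeMap b).measurable
  refine Measurable.lintegral_prod_right' (f := fun p : ℝ × ℝ =>
    ‖f (planeMap b (p.1, p.2 + τ)) - f (planeMap b (p.1, p.2))‖ₑ) ?_
  fun_prop

theorem transDiff_eq_lintegral_slice {f : EuclideanSpace ℝ (Fin 2) → ℝ} (hf : Measurable f)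
    (τ : ℝ) :
    transDiff f (τ • b 1) = ∫⁻ s, transDiff (fun t => f (planeMap b (s, t))) τ := by
  have h := (continuous_planeMap b).measurable
  rw [transDiff, ← (measurePreserving_planeMap b).lintegral_comp (by fun_prop),
    Measure.volume_eq_prod, lintegral_prod _ (by fun_prop)]
  simp only [planeMap_add_smul, transDiff]

theorem dirVar_eq_lintegral_slice {f : EuclideanSpace ℝ (Fin 2) → ℝ} (hf : Measurable f)
    (τ : ℝ) :
    dirVar f (τ • b 1) = ∫⁻ s, dirVar (fun t => f (planeMap b (s, t))) τ := by
  simp only [dirVar]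
  rw [lintegral_iSup]
  · refine iSup_congr fun n => ?_
    rw [smul_smul, transDiff_eq_lintegral_slice b hf,
      lintegral_const_mul _ (measurable_transDiff_slice b hf _), smul_eq_mul]
  · exact fun n => (measurable_transDiff_slice b hf _).const_mul _
  · exact fun m n hmn s => transDiff_dyadic_monotone (measurable_slice b hf s) τ hmn

theorem measurable_dirVar_slice {f : EuclideanSpace ℝ (Fin 2) → ℝ} (hf : Measurable f) (τ : ℝ) :
    Measurable fun s => dirVar (fun t => f (planeMap b (s, t))) τ :=
  Measurable.iSup fun _ => (measurable_transDiff_slice b hf _).const_mul _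

theorem ae_slice_ae_eq {E F : Set (EuclideanSpace ℝ (Fin 2))} (h : E =ᵐ[volume] F) :
    ∀ᵐ s : ℝ, {t : ℝ | planeMap b (s, t) ∈ E} =ᵐ[volume] {t : ℝ | planeMap b (s, t) ∈ F} := by
  have h1 : ∀ᵐ x, (x ∈ E ↔ x ∈ F) := h.mem_iff
  have h2 := (measurePreserving_planeMap b).quasiMeasurePreserving.ae h1
  rw [Measure.volume_eq_prod] at h2
  filter_upwards [Measure.ae_ae_of_ae_prod h2] with s hs
  exact eventuallyEq_set.2 hs

theorem densityZeroPoints_congr_ae {n : ℕ} {E F : Set (EuclideanSpace ℝ (Fin n))}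
    (h : E =ᵐ[volume] F) : densityZeroPoints E = densityZeroPoints F := by
  have : ∀ (x : EuclideanSpace ℝ (Fin n)) r, volume (E ∩ ball x r) = volume (F ∩ ball x r) :=
    fun x r => measure_congr (h.inter (ae_eq_refl _))
  simp only [densityZeroPoints, this]

/-- Almost every line (in a given direction) that meets `F` in a null set consists of points of
density `0` of `F`. -/
theorem ae_slice_subset_densityZeroPoints {F : Set (EuclideanSpace ℝ (Fin 2))}
    (hF : MeasurableSet F) :
    ∀ᵐ s : ℝ, volume {t : ℝ | planeMap b (s, t) ∈ F} = 0 →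
      ∀ t, planeMap b (s, t) ∈ densityZeroPoints F := by
  have hT := (continuous_planeMap b).measurable
  have hFm : MeasurableSet (planeMap b ⁻¹' F) := hT hF
  set N : Set ℝ := {s | volume {t : ℝ | planeMap b (s, t) ∈ F} ≠ 0} with hN
  have hNm : MeasurableSet N :=
    (measurable_measure_prodMk_left hFm) (measurableSet_singleton (0 : ℝ≥0∞)).compl
  -- `N` collects the lines with nonnull slice. By Lebesgue's theorem almost every `s ∉ N` has
  -- density `0` for `N`.
  filter_upwards [Besicovitch.ae_tendsto_measure_inter_div_of_measurableSet volume hNm]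
    with s hs h0 t
  have hsN : s ∉ N := fun h => h h0
  rw [Set.indicator_of_notMem hsN] at hs
  set x := planeMap b (s, t) with hx
  -- Up to a null set, `F` inside the ball lies over `N ∩ [s - r, s + r]`, with slices of length at
  -- most `2r`.
  have hbound : ∀ r : ℝ, 0 < r →
      volume (F ∩ ball x r) ≤ ENNReal.ofReal (2 * r) * volume (N ∩ closedBall s r) := by
    intro r hr
    rw [← (measurePreserving_planeMap b).measure_preimage
      (hF.inter measurableSet_ball).nullMeasurableSet, Measure.volume_eq_prod,
      Measure.prod_apply (hT (hF.inter measurableSet_ball))]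
    calc ∫⁻ s', volume (Prod.mk s' ⁻¹' (planeMap b ⁻¹' (F ∩ ball x r)))
        ≤ ∫⁻ s', (N ∩ closedBall s r).indicator (fun _ => ENNReal.ofReal (2 * r)) s' := by
          refine lintegral_mono fun s' => ?_
          by_cases h1 : s' ∈ N ∩ closedBall s r
          · rw [Set.indicator_of_mem h1, ← Real.volume_closedBall t]
            refine measure_mono fun t' ht' => ?_
            have h2 : dist (planeMap b (s', t')) x < r := ht'.2
            rw [mem_closedBall, Real.dist_eq, ← inner_planeMap_one b s' t',
              ← inner_planeMap_one b s t, ← inner_sub_right, ← hx]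
            refine (abs_real_inner_le_norm _ _).trans ?_
            rw [b.norm_eq_one, one_mul, ← dist_eq_norm]
            exact h2.le
          · rw [Set.indicator_of_notMem h1, nonpos_iff_eq_zero]
            by_cases h2 : s' ∈ N
            · have h3 : s' ∉ closedBall s r := fun h => h1 ⟨h2, h⟩
              refine measure_mono_null (t := ∅) (fun t' ht' => h3 ?_) measure_empty
              have h4 : dist (planeMap b (s', t')) x < r := ht'.2
              rw [mem_closedBall, Real.dist_eq, ← inner_planeMap_zero b s' t',
                ← inner_planeMap_zero b s t, ← inner_sub_right, ← hx]
              refine (abs_real_inner_le_norm _ _).trans ?_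
              rw [b.norm_eq_one, one_mul, ← dist_eq_norm]
              exact h4.le
            · exact measure_mono_null (fun t' ht' => ht'.1) (not_not.1 h2)
      _ = _ := by
          rw [lintegral_indicator_const (hNm.inter measurableSet_closedBall)]
  -- `4 / π` is the ratio of the square of side `2r` to the disc of radius `r`.
  have hlim := ENNReal.Tendsto.const_mul (a := 4 / ENNReal.ofReal Real.pi) hs
    (Or.inr (ENNReal.div_ne_top (by simp) (by simp [Real.pi_pos])))
  rw [mul_zero] at hlim
  refine tendsto_of_tendsto_of_tendsto_of_le_of_le' tendsto_const_nhds hlim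
    (Eventually.of_forall fun _ => bot_le) ?_
  filter_upwards [self_mem_nhdsWithin] with r hr
  rw [Set.mem_Ioi] at hr
  rw [EuclideanSpace.volume_ball_fin_two, Real.volume_closedBall]
  refine (ENNReal.div_le_div_right (hbound r hr) _).trans (le_of_eq ?_)
  have h4 : (2 : ℝ≥0∞) = 4 * 2⁻¹ := by
    rw [show (4 : ℝ≥0∞) = 2 * 2 by norm_num, mul_assoc,
      ENNReal.mul_inv_cancel (by simp) (by simp), mul_one]
  have hR0 : ENNReal.ofReal r ≠ 0 := by simpa using hr
  have hRt : ENNReal.ofReal r ≠ ∞ := ENNReal.ofReal_ne_top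
  rw [ENNReal.ofReal_mul zero_le_two, ENNReal.ofReal_ofNat]
  generalize ENNReal.ofReal r = R at hR0 hRt
  simp only [div_eq_mul_inv]
  rw [ENNReal.mul_inv (Or.inr ENNReal.ofReal_ne_top) (Or.inr (by simp [Real.pi_pos])),
    ENNReal.mul_inv (Or.inl (by simp)) (Or.inl (by simp)), sq,
    ENNReal.mul_inv (Or.inl hR0) (Or.inl hRt)]
  calc _ = R * R⁻¹ * (2 * volume (N ∩ closedBall s r) * R⁻¹ * (ENNReal.ofReal Real.pi)⁻¹) := by
        ring
    _ = 4 * 2⁻¹ * volume (N ∩ closedBall s r) * R⁻¹ * (ENNReal.ofReal Real.pi)⁻¹ := by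
        rw [ENNReal.mul_inv_cancel hR0 hRt, one_mul, ← h4]
    _ = _ := by ring

/-- The projection of a preconnected set to `ℝ b₀` is an interval, hence already convex, so the hull
has the same projection. -/
theorem slice_nonempty_of_convexHull {E : Set (EuclideanSpace ℝ (Fin 2))} (hE : IsPreconnected E)
    {s t : ℝ} (h : planeMap b (s, t) ∈ convexHull ℝ E) : ∃ t', planeMap b (s, t') ∈ E := by
  set ℓ : EuclideanSpace ℝ (Fin 2) →ₗ[ℝ] ℝ := (innerSL ℝ (b 0)).toLinearMap with hℓ
  have hℓc : Continuous ℓ := (innerSL ℝ (b 0)).continuous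
  have h1 : Convex ℝ (ℓ '' E) :=
    (isPreconnected_iff_ordConnected.1 (hE.image _ hℓc.continuousOn)).convex
  have h2 : ℓ (planeMap b (s, t)) ∈ ℓ '' E := by
    rw [← h1.convexHull_eq, ← ℓ.image_convexHull]
    exact ⟨_, h, rfl⟩
  obtain ⟨x, hx, hxs⟩ := h2
  have h3 : inner ℝ (b 0) x = s := by
    rw [← inner_planeMap_zero b s t]; exact hxs
  refine ⟨inner ℝ (b 1) x, ?_⟩
  rwa [← h3, planeMap_inner]

/-- Orthogonal projection is `1`-Lipschitz, so the image of `Z` is Lebesgue null. -/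
theorem ae_slice_notMem_of_hausdorffMeasure_eq_zero {Z : Set (EuclideanSpace ℝ (Fin 2))}
    (hZ : Measure.hausdorffMeasure 1 Z = 0) : ∀ᵐ s : ℝ, ∀ t, planeMap b (s, t) ∉ Z := by
  have hl : LipschitzWith 1 fun x : EuclideanSpace ℝ (Fin 2) => (inner ℝ (b 0) x : ℝ) := by
    refine LipschitzWith.of_dist_le_mul fun x y => ?_
    rw [Real.dist_eq, ← inner_sub_right, dist_eq_norm]
    refine (abs_real_inner_le_norm _ _).trans ?_
    simp
  have h0 : volume ((fun x : EuclideanSpace ℝ (Fin 2) => (inner ℝ (b 0) x : ℝ)) '' Z) = 0 := by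
    rw [← hausdorffMeasure_real]
    have := hl.hausdorffMeasure_image_le zero_le_one Z
    rw [hZ, mul_zero] at this
    exact nonpos_iff_eq_zero.1 this
  filter_upwards [measure_eq_zero_iff_ae_notMem.1 h0] with s hs t ht
  exact hs ⟨_, ht, inner_planeMap_zero b s t⟩

/-- The only place where connectedness and the density hypothesis act: the line contains a point of
`E`, which would have density `0` if the slice were null. -/
theorem ae_volume_slice_ne_zero {E F : Set (EuclideanSpace ℝ (Fin 2))} (hconn : IsPreconnected E)
    (hdens : Measure.hausdorffMeasure 1 (E ∩ densityZeroPoints E) = 0) (hF : MeasurableSet F)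
    (hFE : F =ᵐ[volume] E) :
    ∀ᵐ s : ℝ, (∃ t, planeMap b (s, t) ∈ convexHull ℝ E) →
      volume {t : ℝ | planeMap b (s, t) ∈ F} ≠ 0 := by
  filter_upwards [ae_slice_subset_densityZeroPoints b hF,
    ae_slice_notMem_of_hausdorffMeasure_eq_zero b hdens] with s h1 h2 ⟨t, ht⟩ h0
  obtain ⟨t', ht'⟩ := slice_nonempty_of_convexHull b hconn ht
  refine h2 t' ⟨ht', ?_⟩
  rw [← densityZeroPoints_congr_ae hFE]
  exact h1 h0 t'

theorem ordConnected_slice {C : Set (EuclideanSpace ℝ (Fin 2))} (hC : Convex ℝ C) (s : ℝ) :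
    {t : ℝ | planeMap b (s, t) ∈ C}.OrdConnected := by
  refine Convex.ordConnected fun x hx y hy α β hα hβ hαβ => ?_
  have := hC hx hy hα hβ hαβ
  rw [Set.mem_ofPred_eq]
  convert this using 1
  simp only [planeMap, smul_eq_mul]
  have hs : s = α * s + β * s := by rw [← add_mul, hαβ, one_mul]
  nth_rewrite 1 [hs]
  module

theorem isBounded_slice {C : Set (EuclideanSpace ℝ (Fin 2))} (hC : Bornology.IsBounded C) (s : ℝ) :
    Bornology.IsBounded {t : ℝ | planeMap b (s, t) ∈ C} := by
  obtain ⟨R, hR⟩ := hC.exists_norm_le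
  refine isBounded_iff_forall_norm_le.2 ⟨R, fun t ht => ?_⟩
  rw [← inner_planeMap_one b s t]
  refine (norm_inner_le_norm _ _).trans ?_
  rw [b.norm_eq_one, one_mul]
  exact hR _ ht

end Slicing

/-- Passing to the convex hull of a bounded connected set increases neither `dirVar` nor
`dirVar - transDiff`. -/
theorem dirVar_convexHull_le_and_add_transDiff_le {E F D : Set (EuclideanSpace ℝ (Fin 2))}
    (hb : Bornology.IsBounded E) (hconn : IsPreconnected E)
    (hdens : Measure.hausdorffMeasure 1 (E ∩ densityZeroPoints E) = 0) (hF : MeasurableSet F)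
    (hFE : F =ᵐ[volume] E) (hFs : F ⊆ E) (hD : MeasurableSet D)
    (hDE : D =ᵐ[volume] convexHull ℝ E) (z : EuclideanSpace ℝ (Fin 2)) :
    dirVar (D.indicator 1) z ≤ dirVar (F.indicator 1) z ∧
      dirVar (D.indicator 1) z + transDiff (F.indicator 1) z
        ≤ dirVar (F.indicator 1) z + transDiff (D.indicator 1) z := by
  rcases eq_or_ne z 0 with rfl | hz
  · simp [dirVar, transDiff]
  -- Adapting the basis to `z` makes translation by `z` act within each slice.
  obtain ⟨b, hbz⟩ : ∃ b : OrthonormalBasis (Fin 2) ℝ (EuclideanSpace ℝ (Fin 2)),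
      z = ‖z‖ • b 1 := by
    obtain ⟨b, hb⟩ := Orthonormal.exists_orthonormalBasis_extension_of_card_eq (𝕜 := ℝ)
      (E := EuclideanSpace ℝ (Fin 2)) (ι := Fin 2) (by simp) (v := fun _ => ‖z‖⁻¹ • z) (s := {1})
      ⟨fun i => by simp [norm_smul, hz], fun i j hij => absurd (Subsingleton.elim i j) hij⟩
    refine ⟨b, ?_⟩
    rw [hb 1 rfl, smul_smul, mul_inv_cancel₀ (norm_ne_zero_iff.2 hz), one_smul]
  have hr : 0 < ‖z‖ := norm_pos_iff.2 hz
  have hFm : Measurable (F.indicator (1 : EuclideanSpace ℝ (Fin 2) → ℝ)) :=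
    measurable_one.indicator hF
  have hDm : Measurable (D.indicator (1 : EuclideanSpace ℝ (Fin 2) → ℝ)) :=
    measurable_one.indicator hD
  have key : ∀ᵐ s : ℝ,
      dirVar (fun t => D.indicator (1 : EuclideanSpace ℝ (Fin 2) → ℝ) (planeMap b (s, t))) ‖z‖
        ≤ dirVar (fun t => F.indicator 1 (planeMap b (s, t))) ‖z‖ ∧
      dirVar (fun t => D.indicator (1 : EuclideanSpace ℝ (Fin 2) → ℝ) (planeMap b (s, t))) ‖z‖
          + transDiff (fun t => F.indicator 1 (planeMap b (s, t))) ‖z‖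
        ≤ dirVar (fun t => F.indicator 1 (planeMap b (s, t))) ‖z‖
          + transDiff (fun t => D.indicator 1 (planeMap b (s, t))) ‖z‖ := by
    filter_upwards [ae_volume_slice_ne_zero b hconn hdens hF hFE, ae_slice_ae_eq b hDE]
      with s h1 h2
    have e : ∀ G : Set (EuclideanSpace ℝ (Fin 2)),
        (fun t => G.indicator (1 : EuclideanSpace ℝ (Fin 2) → ℝ) (planeMap b (s, t)))
          = {t : ℝ | planeMap b (s, t) ∈ G}.indicator 1 := fun G => rfl
    have h3 := indicator_ae_eq_of_ae_eq_set (f := (1 : ℝ → ℝ)) h2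
    rw [e, e, dirVar_congr_ae h3, transDiff_congr_ae h3]
    exact dirVar_le_and_add_transDiff_le_of_ordConnected
      (((continuous_planeMap b).measurable.comp measurable_prodMk_left) hF)
      (ordConnected_slice b (convex_convexHull ℝ E) s)
      (isBounded_slice b (isBounded_convexHull.2 hb) s)
      (fun t ht => subset_convexHull ℝ E (hFs ht))
      (fun hv => h1 (nonempty_of_measure_ne_zero hv)) hr
  rw [hbz, dirVar_eq_lintegral_slice b hFm, dirVar_eq_lintegral_slice b hDm,
    transDiff_eq_lintegral_slice b hFm, transDiff_eq_lintegral_slice b hDm,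
    ← lintegral_add_left (measurable_dirVar_slice b hDm _),
    ← lintegral_add_left (measurable_dirVar_slice b hFm _)]
  exact ⟨lintegral_mono_ae (key.mono fun s hs => hs.1),
    lintegral_mono_ae (key.mono fun s hs => hs.2)⟩

/-! ### Normalization of the radial kernel and its rescalings. -/

section Kernel

variable {n : ℕ}

theorem lintegral_polar [Nontrivial (EuclideanSpace ℝ (Fin n))]
    (F : EuclideanSpace ℝ (Fin n) → ℝ≥0∞) :
    ∫⁻ x, F x = ∫⁻ p : sphere (0 : EuclideanSpace ℝ (Fin n)) 1 × Set.Ioi (0 : ℝ),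
      F (p.2.1 • p.1.1) ∂((volume : Measure (EuclideanSpace ℝ (Fin n))).toSphere.prod
        (Measure.volumeIoiPow (Module.finrank ℝ (EuclideanSpace ℝ (Fin n)) - 1))) := by
  have h := (volume : Measure (EuclideanSpace ℝ (Fin n))).measurePreserving_homeomorphUnitSphereProd
  rw [← h.lintegral_comp_emb (Homeomorph.measurableEmbedding _)]
  have e : ∀ x : ({0}ᶜ : Set (EuclideanSpace ℝ (Fin n))),
      ((homeomorphUnitSphereProd _ x).2 : ℝ) •
        ((homeomorphUnitSphereProd _ x).1 : EuclideanSpace ℝ (Fin n)) = x := fun x => by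
    have := homeomorphUnitSphereProd_symm_apply_coe (EuclideanSpace ℝ (Fin n))
      (homeomorphUnitSphereProd _ x)
    rw [← this, Homeomorph.symm_apply_apply]
  simp only [e]
  rw [lintegral_subtype_comap (measurableSet_singleton _).compl, restrict_compl_singleton]

/-- For a radial kernel with normalized first moment, the average of `|L z|` against the kernel is
the norm of the linear functional `L`. -/
theorem lintegral_radial_mul_enorm {G : EuclideanSpace ℝ (Fin n) → ℝ} {g : ℝ → ℝ}
    (hg : Measurable g) (hG0 : ∀ x, 0 ≤ G x) (hGg : ∀ᵐ x, G x = g ‖x‖)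
    (hmom : HasNormalizedFirstMoment G) (L : EuclideanSpace ℝ (Fin n) →L[ℝ] ℝ) :
    ∫⁻ z, ENNReal.ofReal (g ‖z‖) * ‖L z‖ₑ = ‖L‖ₑ := by
  rcases eq_or_ne L 0 with rfl | hL
  · rw [← ofReal_norm]
    simp
  have hLn : 0 < ‖L‖ := norm_pos_iff.2 hL
  set v := dualVector L with hv
  have hvn : ‖v‖ = ‖L‖ := norm_dualVector L
  set ν := ‖L‖⁻¹ • v with hν
  have hνn : ‖ν‖ = 1 := by
    rw [hν, norm_smul, hvn, norm_inv, norm_norm, inv_mul_cancel₀ hLn.ne']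
  have hLν : ∀ z, L z = ‖L‖ * inner ℝ z ν := fun z => by
    rw [hν, real_inner_smul_right, mul_inv_cancel_left₀ hLn.ne', real_inner_comm,
      ← innerSL_apply_apply ℝ, hv, innerSL_dualVector]
  have : Nontrivial (EuclideanSpace ℝ (Fin n)) :=
    ⟨ν, 0, fun h => by rw [h, norm_zero] at hνn; exact zero_ne_one hνn⟩
  set S := (volume : Measure (EuclideanSpace ℝ (Fin n))).toSphere with hS
  set μ := Measure.volumeIoiPow (Module.finrank ℝ (EuclideanSpace ℝ (Fin n)) - 1) with hμ
  set J : ℝ≥0∞ := ∫⁻ r : Set.Ioi (0 : ℝ), ENNReal.ofReal (g r) * ‖(r : ℝ)‖ₑ ∂μ with hJ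
  set c : sphere (0 : EuclideanSpace ℝ (Fin n)) 1 → ℝ :=
    fun σ => |inner ℝ (σ : EuclideanSpace ℝ (Fin n)) ν| with hc
  have hcc : Continuous c := by fun_prop
  have hcs : HasCompactSupport c := HasCompactSupport.of_compactSpace c
  have hci : Integrable c S := hcc.integrable_of_hasCompactSupport hcs
  have hpos : 0 < ∫ σ, c σ ∂S :=
    hcc.integral_pos_of_hasCompactSupport_nonneg_nonzero (x := ⟨ν, by simp [hνn]⟩) hcs
      (fun σ => abs_nonneg _) (by simp [hc, hνn])
  have hrm : Measurable fun r : Set.Ioi (0 : ℝ) => ENNReal.ofReal (g r) * ‖(r : ℝ)‖ₑ := by fun_prop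
  have hS0 : S Set.univ ≠ 0 := Measure.measure_univ_ne_zero.2 (Measure.toSphere_ne_zero _)
  have hSt : S Set.univ ≠ ∞ := measure_ne_top _ _
  -- In polar coordinates this integral and the first moment share the radial factor `J`. The moment
  -- condition fixes `J` as the inverse of the spherical integral of `|σ · ν|`.
  have e1 : ∫⁻ z, ENNReal.ofReal (g ‖z‖) * ‖(inner ℝ z ν : ℝ)‖ₑ
      = ENNReal.ofReal (∫ σ, c σ ∂S) * J := by
    rw [ofReal_integral_eq_lintegral_ofReal hci (Eventually.of_forall fun σ => abs_nonneg _),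
      hJ, ← lintegral_prod_mul hcc.measurable.ennreal_ofReal.aemeasurable hrm.aemeasurable,
      lintegral_polar]
    refine lintegral_congr fun p => ?_
    have h1 : ‖(p.2 : ℝ) • (p.1 : EuclideanSpace ℝ (Fin n))‖ = p.2 := by
      rw [norm_smul, norm_eq_of_mem_sphere, mul_one, Real.norm_of_nonneg p.2.2.le]
    rw [h1, real_inner_smul_left, enorm_mul, Real.enorm_eq_ofReal_abs (inner ℝ _ _)]
    ring
  have e2 : ∫⁻ z : EuclideanSpace ℝ (Fin n), ENNReal.ofReal (g ‖z‖) * ‖z‖ₑ = S Set.univ * J := by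
    have h0 := lintegral_prod_mul (μ := S) (ν := μ) (f := fun _ => 1) aemeasurable_const
      hrm.aemeasurable
    rw [lintegral_one] at h0
    rw [lintegral_polar, hJ, ← h0]
    refine lintegral_congr fun p => ?_
    have h1 : ‖(p.2 : ℝ) • (p.1 : EuclideanSpace ℝ (Fin n))‖ = p.2 := by
      rw [norm_smul, norm_eq_of_mem_sphere, mul_one, Real.norm_of_nonneg p.2.2.le]
    rw [← ofReal_norm ((p.2 : ℝ) • (p.1 : EuclideanSpace ℝ (Fin n))), h1,
      Real.enorm_eq_ofReal p.2.2.le, one_mul]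
  have e3 : ∫⁻ z : EuclideanSpace ℝ (Fin n), ENNReal.ofReal (g ‖z‖) * ‖z‖ₑ
      = ENNReal.ofReal (S.real Set.univ / ∫ σ, c σ ∂S) := by
    have h1 := hmom.2 ν hνn
    rw [sphereMeanAbsInner, average_eq, smul_eq_mul, one_div, mul_inv, inv_inv] at h1
    rw [div_eq_mul_inv]
    change _ = ENNReal.ofReal ((volume : Measure (EuclideanSpace ℝ (Fin n))).toSphere.real Set.univ *
      (∫ σ : sphere (0 : EuclideanSpace ℝ (Fin n)) 1,
        |inner ℝ (σ : EuclideanSpace ℝ (Fin n)) ν| ∂volume.toSphere)⁻¹)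
    rw [← h1, ofReal_integral_eq_lintegral_ofReal hmom.1
      (Eventually.of_forall fun x => mul_nonneg (norm_nonneg _) (hG0 x))]
    refine lintegral_congr_ae ?_
    filter_upwards [hGg] with x hx
    rw [hx, ENNReal.ofReal_mul (norm_nonneg _), ofReal_norm, mul_comm]
  have e4 : ENNReal.ofReal (∫ σ, c σ ∂S) * J = 1 := by
    have h1 : S Set.univ * J = S Set.univ * (ENNReal.ofReal (∫ σ, c σ ∂S))⁻¹ := by
      rw [← e2, e3, div_eq_mul_inv, ENNReal.ofReal_mul measureReal_nonneg,
        ENNReal.ofReal_inv_of_pos hpos, measureReal_def, ENNReal.ofReal_toReal hSt]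
    rw [(ENNReal.mul_right_inj hS0 hSt).1 h1]
    exact ENNReal.mul_inv_cancel (by simpa using hpos) ENNReal.ofReal_ne_top
  calc ∫⁻ z, ENNReal.ofReal (g ‖z‖) * ‖L z‖ₑ
      = ∫⁻ z, ‖L‖ₑ * (ENNReal.ofReal (g ‖z‖) * ‖(inner ℝ z ν : ℝ)‖ₑ) := by
        refine lintegral_congr fun z => ?_
        rw [hLν, enorm_mul, enorm_norm]
        ring
    _ = ‖L‖ₑ := by rw [lintegral_const_mul _ (by fun_prop), e1, e4, mul_one]

theorem lintegral_comp_inv_smul (F : EuclideanSpace ℝ (Fin n) → ℝ≥0∞) {ε : ℝ} (hε : 0 < ε) :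
    ∫⁻ x, F (ε⁻¹ • x) = ENNReal.ofReal (ε ^ n) * ∫⁻ x, F x := by
  have h := Measure.map_addHaar_smul (volume : Measure (EuclideanSpace ℝ (Fin n)))
    (inv_ne_zero hε.ne')
  have h2 : MeasurableEmbedding fun x : EuclideanSpace ℝ (Fin n) => ε⁻¹ • x :=
    (Homeomorph.smulOfNeZero ε⁻¹ (inv_ne_zero hε.ne')).measurableEmbedding
  have h3 := h2.lintegral_map (μ := volume) F
  rw [← h3]
  change ∫⁻ a, F a ∂(Measure.map (ε⁻¹ • ·) volume) = _
  rw [h, lintegral_smul_measure, smul_eq_mul, finrank_euclideanSpace_fin]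
  congr 2
  rw [inv_pow, inv_inv, abs_of_nonneg (by positivity)]

/-- The radial profile of the rescaled kernel, with values in `[0, ∞]`. -/
def rescaledProfile (n : ℕ) (g : ℝ → ℝ) (ε : ℝ) (z : EuclideanSpace ℝ (Fin n)) : ℝ≥0∞ :=
  ENNReal.ofReal ((ε ^ (n + 1))⁻¹ * g ‖ε⁻¹ • z‖)

theorem measurable_rescaledProfile {g : ℝ → ℝ} (hg : Measurable g) (ε : ℝ) :
    Measurable (rescaledProfile n g ε) := by
  unfold rescaledProfile
  fun_prop

theorem rescaledProfile_neg (g : ℝ → ℝ) (ε : ℝ) (z : EuclideanSpace ℝ (Fin n)) :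
    rescaledProfile n g ε (-z) = rescaledProfile n g ε z := by
  simp only [rescaledProfile, smul_neg, norm_neg]

theorem ofReal_rescaledKernel_ae_eq {G : EuclideanSpace ℝ (Fin n) → ℝ} {g : ℝ → ℝ}
    (hGg : ∀ᵐ x, G x = g ‖x‖) {ε : ℝ} (hε : 0 < ε) :
    ∀ᵐ z, ENNReal.ofReal (rescaledKernel G ε z) = rescaledProfile n g ε z := by
  have h := Measure.quasiMeasurePreserving_smul (volume : Measure (EuclideanSpace ℝ (Fin n)))
    (inv_ne_zero hε.ne')
  filter_upwards [h.ae hGg] with z hz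
  rw [rescaledKernel, rescaledProfile, hz]

/-- Scale invariance: of the power `n + 1` in the kernel, `n` cancels the Jacobian and `1` the
homogeneity of `L`. -/
theorem lintegral_rescaledProfile_mul_enorm {G : EuclideanSpace ℝ (Fin n) → ℝ} {g : ℝ → ℝ}
    (hg : Measurable g) (hG0 : ∀ x, 0 ≤ G x) (hGg : ∀ᵐ x, G x = g ‖x‖)
    (hmom : HasNormalizedFirstMoment G) {ε : ℝ} (hε : 0 < ε)
    (L : EuclideanSpace ℝ (Fin n) →L[ℝ] ℝ) :
    ∫⁻ z, rescaledProfile n g ε z * ‖L z‖ₑ = ‖L‖ₑ := by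
  have hp : (0 : ℝ) < ε ^ n := by positivity
  calc ∫⁻ z, rescaledProfile n g ε z * ‖L z‖ₑ
      = ∫⁻ z, (ENNReal.ofReal (ε ^ n))⁻¹ *
          (fun y => ENNReal.ofReal (g ‖y‖) * ‖L y‖ₑ) (ε⁻¹ • z) := by
        refine lintegral_congr fun z => ?_
        simp only [rescaledProfile, map_smul, smul_eq_mul, enorm_mul]
        rw [ENNReal.ofReal_mul (by positivity), ← ENNReal.ofReal_inv_of_pos hp,
          Real.enorm_eq_ofReal (inv_nonneg.2 hε.le), pow_succ, mul_inv,
          ENNReal.ofReal_mul (by positivity)]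
        ring
    _ = ‖L‖ₑ := by
        rw [lintegral_const_mul' _ _ (by simp [hp]),
          lintegral_comp_inv_smul (fun y => ENNReal.ofReal (g ‖y‖) * ‖L y‖ₑ) hε,
          lintegral_radial_mul_enorm hg hG0 hGg hmom,
          ENNReal.inv_mul_cancel_left (by simpa using hp) ENNReal.ofReal_ne_top]

end Kernel

end

/-! ### The convex hull inequality. -/

theorem mainTheorem6
    (G : EuclideanSpace ℝ (Fin 2) → ℝ)
    (hrad : IsRadialKernel G)
    (hmom : HasNormalizedFirstMoment G)
    (E : Set (EuclideanSpace ℝ (Fin 2)))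
    (hbdd : Bornology.IsBounded E)
    (hconn : IsPreconnected E)
    (hper : HasFinitePerimeter E)
    (hdens : Measure.hausdorffMeasure 1 (E ∩ densityZeroPoints E) = 0)
    (ε : ℝ) (hε : 0 < ε) :
    HasFinitePerimeter (convexHull ℝ E) ∧
      nonlocalPerimeter (rescaledKernel G ε) E ≠ ∞ ∧
      nonlocalPerimeter (rescaledKernel G ε) (convexHull ℝ E) ≠ ∞ ∧
      criticalEnergy (rescaledKernel G ε) (convexHull ℝ E) ≤
        criticalEnergy (rescaledKernel G ε) E := by
  obtain ⟨hG0, g, hg, -, hGg⟩ := hrad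
  set k := rescaledProfile 2 g ε with hk
  have hkm : Measurable k := measurable_rescaledProfile hg ε
  have hN := lintegral_rescaledProfile_mul_enorm hg hG0 hGg hmom hε
  have hK := ofReal_rescaledKernel_ae_eq hGg hε
  have hbC : Bornology.IsBounded (convexHull ℝ E) := isBounded_convexHull.2 hbdd
  have hCn : NullMeasurableSet (convexHull ℝ E) volume :=
    (convex_convexHull ℝ E).nullMeasurableSet volume
  -- A measurable version inside `E` keeps every slice of `F` within the corresponding slice of the
  -- hull.
  obtain ⟨F, hFs, hF, hFE⟩ := hper.nullMeasurable.exists_measurable_subset_ae_eq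
  obtain ⟨D, hDs, hD, hDC⟩ := hCn.exists_measurable_subset_ae_eq
  have hFm : Measurable (F.indicator (1 : EuclideanSpace ℝ (Fin 2) → ℝ)) :=
    measurable_one.indicator hF
  have hDm : Measurable (D.indicator (1 : EuclideanSpace ℝ (Fin 2) → ℝ)) :=
    measurable_one.indicator hD
  have pE : perimeter E = ∫⁻ z, k z * dirVar (F.indicator 1) z := by
    rw [← perimeter_congr_ae hFE]
    exact perimeter_eq_lintegral_dirVar hkm hN hF (hbdd.subset hFs)
  have pC : perimeter (convexHull ℝ E) = ∫⁻ z, k z * dirVar (D.indicator 1) z := by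
    rw [← perimeter_congr_ae hDC]
    exact perimeter_eq_lintegral_dirVar hkm hN hD (hbC.subset hDs)
  have qE : nonlocalPerimeter (rescaledKernel G ε) E
      = ∫⁻ z, k z * transDiff (F.indicator 1) z :=
    nonlocalPerimeter_eq_lintegral_transDiff hkm (rescaledProfile_neg g ε) hK hF hFE.symm
  have qC : nonlocalPerimeter (rescaledKernel G ε) (convexHull ℝ E)
      = ∫⁻ z, k z * transDiff (D.indicator 1) z :=
    nonlocalPerimeter_eq_lintegral_transDiff hkm (rescaledProfile_neg g ε) hK hD hDC.symm
  have hpt := dirVar_convexHull_le_and_add_transDiff_le hbdd hconn hdens hF hFE hFs hD hDC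
  have hCE : perimeter (convexHull ℝ E) ≤ perimeter E := by
    rw [pE, pC]
    exact lintegral_mono fun z => mul_le_mul_right (hpt z).1 _
  -- The energy inequality in additive form, free of subtraction in `ℝ≥0∞`; finiteness of all four
  -- terms then allows passing to real numbers.
  have key : perimeter (convexHull ℝ E) + nonlocalPerimeter (rescaledKernel G ε) E
      ≤ perimeter E + nonlocalPerimeter (rescaledKernel G ε) (convexHull ℝ E) := by
    have mD : Measurable fun z => k z * dirVar (D.indicator 1) z := hkm.mul (measurable_dirVar hDm)
    have mF : Measurable fun z => k z * dirVar (F.indicator 1) z := hkm.mul (measurable_dirVar hFm)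
    rw [pE, pC, qE, qC, ← lintegral_add_left mD, ← lintegral_add_left mF]
    refine lintegral_mono fun z => ?_
    rw [← mul_add, ← mul_add]
    exact mul_le_mul_right (hpt z).2 _
  have hqE : nonlocalPerimeter (rescaledKernel G ε) E ≤ perimeter E := by
    rw [pE, qE]
    exact lintegral_mono fun z => mul_le_mul_right (transDiff_le_dirVar _ _) _
  have hqC : nonlocalPerimeter (rescaledKernel G ε) (convexHull ℝ E)
      ≤ perimeter (convexHull ℝ E) := by
    rw [pC, qC]
    exact lintegral_mono fun z => mul_le_mul_right (transDiff_le_dirVar _ _) _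
  have hpE := hper.perimeter_ne_top
  have hpC := ne_top_of_le_ne_top hpE hCE
  have hqE' := ne_top_of_le_ne_top hpE hqE
  have hqC' := ne_top_of_le_ne_top hpC hqC
  refine ⟨⟨hCn, hbC.measure_lt_top.ne, hpC⟩, hqE', hqC', ?_⟩
  have h := ENNReal.toReal_mono (ENNReal.add_ne_top.2 ⟨hpE, hqC'⟩) key
  rw [ENNReal.toReal_add hpC hqE', ENNReal.toReal_add hpE hqC'] at h
  simp only [criticalEnergy]
  linarith
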